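/- Setting. There are $k$ arms, groups $G_1,\dots,G_g\subseteq[k]$ and real bounds $\ell_i,u_i$. Let $\mathcal C$ be the polytope of probability vectors $p\in\mathbb R^k$ with $\ell_i\le\sum_{a\in G_i}p_a\le u_i$ for all $i$, let $V(\mathcal C)$ be its set of vertices, let $\mu^\star\in\mathbb R^k$, let $v^\star\in V(\mathcal C)$ maximize $\langle\mu^\star,v\rangle$ over $V(\mathcal C)$, and assume that the gap $\gamma=\langle\mu^\star,v^\star\rangle-\max_{v\in V(\mathcal C)\setminus\{v^\star\}}\langle\mu^\star,v\rangle$ is positive. Protocol. In round $t=1,\dots,T$ the learner chooses $p^t\in\mathcal C$ from the past, an arm $a^t\sim p^t$ is drawn (given the past), a reward vector $(r^t_1,\dots,r^t_k)$ with mean $\mu^\star$ is drawn from a fixed distribution, independently of the past and of $a^t$, and $r_t=r^t_{a^t}$ is observed. The rewards are subgaussian in the following sense: for every vertex $p$ of $\mathcal C$, the reward $r$ observed when the arm is drawn from $p$ satisfies $\mathbb E\,e^{\lambda(r-\langle\mu^\star,p\rangle)}\le e^{\lambda^2/4}$ for all $\lambda\in\mathbb R$ (this holds for example for all rewards in $[0,1]$).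 The fair regret is $\mathsf{FairRegret}_T=\sum_{t=1}^T\big(\max_{q\in\mathcal C}\langle\mu^\star,q\rangle-\langle\mu^\star,p^t\rangle\big)$. Algorithm. $L_1$-OFUL with inputs $\mathcal C$, $\delta\in(0,1)$, $\sigma$ and $T$ uses $V_t=I+\sum_{s<t}p^s(p^s)^\top$, $\hat\mu_t=V_t^{-1}\sum_{s<t}r_sp^s$, $\beta_t=\Big(\sqrt{2\log\big((\det V_t/\delta)^{1/2}\big)}+\sigma\Big)^2$ and $B_t=\{\mu:\|V_t^{1/2}(\mu-\hat\mu_t)\|_1\le\sqrt{k\beta_t}\}$, and plays a vertex $p^t$ of $\mathcal C$ that maximizes $\max_{\mu\in B_t}\langle\mu,p\rangle$ over $p\in\mathcal C$ (ties broken arbitrarily among such vertices). Theorem. Assume $\|\mu^\star\|_2\le\sigma$ with $\sigma\ge1$. (i) For all $T\ge1$ and $\delta\in(0,1)$, with probability at least $1-\delta$, $$\mathsf{FairRegret}_T\le\frac{8k\sigma^2}{\gamma}\Big(\log T+(k-1)\log\frac{64\sigma^2}{\gamma^2}+2(k-1)\log\big(k\log(1+T/k)+2\log(1/\delta)\big)+2\log(1/\delta)\Big)^2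 .$$ (ii) With $\delta=1/T$, as $T\to\infty$, $\mathbb E[\mathsf{FairRegret}_T]=O\big(\frac k\gamma(\log^2T+k\log T+k^2\log\log T)\big)$: there is an absolute constant $K$ such that for all $k,\sigma,\gamma$ there is $T_0$ (depending only on $k,\sigma,\gamma$) with $\mathbb E[\mathsf{FairRegret}_T]\le K\frac k\gamma(\log^2T+k\log T+k^2\log\log T)$ for all $T\ge T_0$ and all instances with these parameters. -/

import Mathlib

open MeasureTheory ProbabilityTheory Matrix
open scoped NNReal ENNReal Matrix MatrixOrder

noncomputable section

/-- The polytope of fair distributions on the `k` arms: the probability vectors that give each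
group `G i` a mass between `l i` and `u i`. -/
def fairPolytope {k g : ℕ} (G : Fin g → Finset (Fin k)) (l u : Fin g → ℝ) : Set (Fin k → ℝ) :=
  {p | p ∈ stdSimplex ℝ (Fin k) ∧ ∀ i, l i ≤ ∑ a ∈ G i, p a ∧ ∑ a ∈ G i, p a ≤ u i}

/-- The vertices of a polytope. -/
def vertices {k : ℕ} (C : Set (Fin k → ℝ)) : Set (Fin k → ℝ) := C.extremePoints ℝ

/-- `v` is a best vertex of `C` for the linear functional `μ`. -/
def IsBestVertex {k : ℕ} (C : Set (Fin k → ℝ)) (μ v : Fin k → ℝ) : Prop :=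
  v ∈ vertices C ∧ ∀ w ∈ vertices C, μ ⬝ᵥ w ≤ μ ⬝ᵥ v

/-- The gap between the value of the vertex `vstar` and the largest value of any other vertex. -/
def vertexGap {k : ℕ} (C : Set (Fin k → ℝ)) (μ vstar : Fin k → ℝ) : ℝ :=
  μ ⬝ᵥ vstar - sSup ((fun v => μ ⬝ᵥ v) '' (vertices C \ {vstar}))

/-- The law of the observed reward when an arm is drawn from `p` and the vector of rewards of the
arms is drawn from `D` independently of it. -/
def rewardLaw {k : ℕ} (D : Measure (Fin k → ℝ)) (p : Fin k → ℝ) : Measure ℝ :=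
  ∑ a, ENNReal.ofReal (p a) • D.map (fun x => x a)

/-- The reward distribution `D` has mean vector `μ`, and the reward observed when playing a vertex
`p` of `C` is sub-Gaussian around its mean `⟨μ, p⟩` with variance proxy `c`. -/
structure IsSubgaussianReward {k : ℕ} (C : Set (Fin k → ℝ)) (μ : Fin k → ℝ) (c : ℝ≥0)
    (D : Measure (Fin k → ℝ)) : Prop where
  integrable : ∀ a, Integrable (fun x => x a) D
  mean : ∀ a, ∫ x, x a ∂D = μ a
  subgaussian : ∀ p ∈ vertices C, HasSubgaussianMGF (fun x => x - μ ⬝ᵥ p) c (rewardLaw D p)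

/-- The weighted `1`-norm `∑ i, |(A ^ (1/2) x) i|`. -/
def weightedL1Norm {k : ℕ} (A : Matrix (Fin k) (Fin k) ℝ) (x : Fin k → ℝ) : ℝ :=
  ∑ i, |(CFC.sqrt A *ᵥ x) i|

/-- `V = I + ∑ p pᵀ` over the first `t` rounds. Rounds are counted from `0`. -/
def designMatrix {k : ℕ} (p : ℕ → Fin k → ℝ) (t : ℕ) : Matrix (Fin k) (Fin k) ℝ :=
  1 + ∑ s ∈ Finset.range t, vecMulVec (p s) (p s)

/-- The regularized least-squares estimate `V⁻¹ b`, `b = ∑ r p`, after the first `t` rounds. -/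
def estimate {k : ℕ} (p : ℕ → Fin k → ℝ) (r : ℕ → ℝ) (t : ℕ) : Fin k → ℝ :=
  (designMatrix p t)⁻¹ *ᵥ (∑ s ∈ Finset.range t, r s • p s)

/-- The squared confidence width `β` before round `t`. -/
def confWidth {k : ℕ} (σ δ : ℝ) (p : ℕ → Fin k → ℝ) (t : ℕ) : ℝ :=
  (√(2 * Real.log (((designMatrix p t).det / δ) ^ (1 / 2 : ℝ))) + σ) ^ 2

/-- The confidence set (a scaled `1`-norm ball) before round `t`. -/
def confSet {k : ℕ} (σ δ : ℝ) (p : ℕ → Fin k → ℝ) (r : ℕ → ℝ) (t : ℕ) : Set (Fin k → ℝ) :=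
  {m | weightedL1Norm (designMatrix p t) (m - estimate p r t) ≤ √(k * confWidth σ δ p t)}

/-- The optimistic value `max_{m ∈ B} ⟨m, q⟩` of a distribution `q`. -/
def optimisticValue {k : ℕ} (B : Set (Fin k → ℝ)) (q : Fin k → ℝ) : ℝ :=
  sSup ((fun m => m ⬝ᵥ q) '' B)

/-- `p 0, …, p (T - 1)` are the distributions that L1-OFUL computes when it observes the rewards
`r 0, …, r (T - 1)`: in each round, a vertex of `C` (an output of the linear programming oracle)
that maximizes the optimistic value over all of `C`. -/
def IsL1OFULSequence {k : ℕ} (C : Set (Fin k → ℝ)) (σ δ : ℝ) (T : ℕ) (p : ℕ → Fin k → ℝ)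
    (r : ℕ → ℝ) : Prop :=
  ∀ t < T, p t ∈ vertices C ∧
    ∀ q ∈ C, optimisticValue (confSet σ δ p r t) q ≤ optimisticValue (confSet σ δ p r t) (p t)

/-- A run of L1-OFUL for `T` rounds on a probability space: in round `t` (counted from `0`) the
distribution `p t` is computed from the past `ℱ t`, the arm `a t` is drawn from `p t` given the
past, the reward vector `X t` is drawn from `D` independently of the past and of the arm, and the
reward `X t (a t)` is observed. -/
structure IsL1OFULRun {k : ℕ} (C : Set (Fin k → ℝ)) (σ δ : ℝ) (T : ℕ) (D : Measure (Fin k → ℝ))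
    {Ω : Type*} {mΩ : MeasurableSpace Ω} (P : Measure Ω) (ℱ : Filtration ℕ mΩ)
    (X : ℕ → Ω → Fin k → ℝ) (a : ℕ → Ω → Fin k) (p : ℕ → Ω → Fin k → ℝ) : Prop where
  plays : ∀ ω, IsL1OFULSequence C σ δ T (fun t => p t ω) (fun t => X t ω (a t ω))
  measurable_dist : ∀ t < T, Measurable[ℱ t] (p t)
  measurable_arm : ∀ t < T, Measurable[ℱ (t + 1)] (a t)
  measurable_obs : ∀ t < T, Measurable[ℱ (t + 1)] (fun ω => X t ω (a t ω))
  arm_law : ∀ t < T, ∀ i, P[(a t ⁻¹' {i}).indicator (fun _ => (1 : ℝ)) | ℱ t]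
    =ᵐ[P] fun ω => p t ω i
  measurable_reward : ∀ t < T, Measurable (X t)
  reward_law : ∀ t < T, P.map (X t) = D
  indep : ∀ t < T, Indep (MeasurableSpace.comap (X t) inferInstance)
    (ℱ t ⊔ MeasurableSpace.comap (a t) inferInstance) P

/-- The fair regret `∑ₜ (max_{q ∈ C} ⟨μ, q⟩ - ⟨μ, p t⟩)` of the distributions `p` after `T`
rounds. -/
def fairRegret {k : ℕ} (C : Set (Fin k → ℝ)) (μ : Fin k → ℝ) (p : ℕ → Fin k → ℝ) (T : ℕ) : ℝ :=
  ∑ t ∈ Finset.range T, (sSup ((fun q => μ ⬝ᵥ q) '' C) - μ ⬝ᵥ p t)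

end

/-! Write `V` for the design matrix and `S` for the noise-weighted sum of plays. The process
`exp(‖S‖²) / √det V`, with the norm of `V⁻¹`, is a nonnegative supermartingale started at 1: a round
changes `V` by a rank-one term, and a Gaussian integral linearizes the new square so that the moment
bound `exp(λ²/4)` applies (`HasSubgaussianMGF.lintegral_exp_quadratic_le`,
`IsL1OFULRun.setLIntegral_mixtureValue_succ_le`). Ville's inequality then controls `S` in all rounds
at once, outside an event of probability at most `δ`; everything else is deterministic on the
remaining event.

There `μ` is within `confRadius` of the estimate in the norm of `V`. The `1`-norm ball contains this
ellipsoid and lies in its dilation by `√k`, so optimism bounds the regret `Δ` of a round by `(√k +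
1)` times the radius times the square root of the leverage (`regret_le_of_optimistic`). A suboptimal
vertex has `Δ ≥ γ`, hence `γ Δ ≤ Δ²`, and the leverages of the suboptimal rounds must be summed.

The gain over the usual analysis comes from erasing the plays of the best vertex. Erasure only
raises the leverage of the other rounds, and their sum is at most `E / log 2`, where `E` is the
log-determinant of the erased design. With `N` suboptimal plays, `E ≤ k log(1 + N/k)`, while the
full log-determinant `D` is at most `log(1 + T - N) + E`, because the erased plays all point in one
direction. Thus `fairRegret_bounds` gives `γ R ≲ k (√(D + log(1/δ)) + σ)² E`, together with `γ N ≤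
R`. This is self-bounding: `N` enters the right side only through logarithms, so a crude bound on
`N` already makes `E` of order `k log log T` for fixed parameters. The explicit bound carries this
out with constants; the asymptotic one only needs `E ≤ log T`. -/

noncomputable section

/-! ### Positive definite forms and rank-one updates. -/

section PosDef

variable {n : Type*} [Fintype n] {A B : Matrix n n ℝ}

theorem Matrix.IsHermitian.dotProduct_mulVec_comm (hA : A.IsHermitian) (x y : n → ℝ) :
    x ⬝ᵥ A *ᵥ y = y ⬝ᵥ A *ᵥ x := by
  have h : Aᵀ = A := by simpa [conjTranspose_eq_transpose_of_trivial] using hA.eq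
  rw [dotProduct_mulVec, ← mulVec_transpose, h, dotProduct_comm]

theorem Matrix.PosSemidef.quadForm_nonneg (hA : A.PosSemidef) (x : n → ℝ) :
    0 ≤ x ⬝ᵥ A *ᵥ x := by
  simpa using hA.dotProduct_mulVec_nonneg x

theorem Matrix.PosSemidef.dotProduct_mulVec_sq_le (hA : A.PosSemidef) (x y : n → ℝ) :
    (x ⬝ᵥ A *ᵥ y) ^ 2 ≤ (x ⬝ᵥ A *ᵥ x) * (y ⬝ᵥ A *ᵥ y) := by
  have h : ∀ t : ℝ, 0 ≤ (x ⬝ᵥ A *ᵥ x) * (t * t) + (2 * (x ⬝ᵥ A *ᵥ y)) * t + y ⬝ᵥ A *ᵥ y := by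
    intro t
    have h1 := hA.quadForm_nonneg (t • x + y)
    have h2 := hA.isHermitian.dotProduct_mulVec_comm y x
    simp only [mulVec_add, mulVec_smul, dotProduct_add, add_dotProduct, smul_dotProduct,
      dotProduct_smul, smul_eq_mul, h2] at h1
    linarith
  have := discrim_le_zero h
  rw [discrim] at this
  nlinarith

theorem Matrix.PosDef.add_smul_vecMulVec (hA : A.PosDef) {c : ℝ} (hc : 0 ≤ c) (v : n → ℝ) :
    (A + c • vecMulVec v v).PosDef := by
  have h : (vecMulVec v v).PosSemidef := by simpa using posSemidef_vecMulVec_self_star v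
  exact hA.add_posSemidef (h.smul hc)

theorem Matrix.PosDef.add_vecMulVec (hA : A.PosDef) (v : n → ℝ) :
    (A + vecMulVec v v).PosDef := by
  simpa using hA.add_smul_vecMulVec zero_le_one v

variable [DecidableEq n]

theorem Matrix.PosDef.mulVec_inv_mulVec (hA : A.PosDef) (x : n → ℝ) : A *ᵥ (A⁻¹ *ᵥ x) = x := by
  rw [mulVec_mulVec, mul_nonsing_inv _ ((isUnit_iff_isUnit_det A).1 hA.isUnit), one_mulVec]

theorem Matrix.PosDef.inv_mulVec_mulVec (hA : A.PosDef) (x : n → ℝ) : A⁻¹ *ᵥ (A *ᵥ x) = x := by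
  rw [mulVec_mulVec, nonsing_inv_mul _ ((isUnit_iff_isUnit_det A).1 hA.isUnit), one_mulVec]

/-- Cauchy–Schwarz for the norm of a positive definite matrix and its dual norm. -/
theorem Matrix.PosDef.dotProduct_sq_le (hA : A.PosDef) (x y : n → ℝ) :
    (x ⬝ᵥ y) ^ 2 ≤ (x ⬝ᵥ A *ᵥ x) * (y ⬝ᵥ A⁻¹ *ᵥ y) := by
  have h := hA.posSemidef.dotProduct_mulVec_sq_le x (A⁻¹ *ᵥ y)
  rwa [hA.mulVec_inv_mulVec, dotProduct_comm (A⁻¹ *ᵥ y) y] at h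

/-- Inversion reverses the Loewner order: apply Cauchy–Schwarz for `A` to the pair `B⁻¹ y`, `y` and
cancel one factor. -/
theorem Matrix.PosDef.inv_quadForm_le (hA : A.PosDef) (hB : B.PosDef)
    (h : ∀ x, x ⬝ᵥ A *ᵥ x ≤ x ⬝ᵥ B *ᵥ x) (y : n → ℝ) :
    y ⬝ᵥ B⁻¹ *ᵥ y ≤ y ⬝ᵥ A⁻¹ *ᵥ y := by
  have h1 := hA.dotProduct_sq_le (B⁻¹ *ᵥ y) y
  have h2 := h (B⁻¹ *ᵥ y)
  rw [hB.mulVec_inv_mulVec, dotProduct_comm (B⁻¹ *ᵥ y) y] at h2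
  rw [dotProduct_comm (B⁻¹ *ᵥ y) y] at h1
  have h3 := hB.inv.posSemidef.quadForm_nonneg y
  have h4 := hA.inv.posSemidef.quadForm_nonneg y
  have h5 : (y ⬝ᵥ B⁻¹ *ᵥ y) ^ 2 ≤ (y ⬝ᵥ B⁻¹ *ᵥ y) * (y ⬝ᵥ A⁻¹ *ᵥ y) :=
    h1.trans (mul_le_mul_of_nonneg_right h2 h4)
  by_contra! hc
  nlinarith

theorem Matrix.PosDef.det_add_smul_vecMulVec (hA : A.PosDef) (c : ℝ) (v : n → ℝ) :
    (A + c • vecMulVec v v).det = A.det * (1 + c * (v ⬝ᵥ A⁻¹ *ᵥ v)) := by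
  have h := det_add_replicateCol_mul_replicateRow (ι := Unit)
    ((isUnit_iff_isUnit_det A).1 hA.isUnit) (c • v) v
  rw [← vecMulVec_eq, smul_vecMulVec] at h
  rw [h]
  congr 1
  simp [det_unique, Matrix.mul_apply, dotProduct, mulVec, Finset.mul_sum, Finset.sum_mul]
  rw [Finset.sum_comm]
  refine Finset.sum_congr rfl fun i _ => Finset.sum_congr rfl fun j _ => by ring

theorem Matrix.PosDef.det_add_vecMulVec (hA : A.PosDef) (v : n → ℝ) :
    (A + vecMulVec v v).det = A.det * (1 + v ⬝ᵥ A⁻¹ *ᵥ v) := by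
  simpa using hA.det_add_smul_vecMulVec 1 v

theorem Matrix.PosDef.add_vecMulVec_inv_mulVec (hA : A.PosDef) (v y : n → ℝ) :
    (A + vecMulVec v v)⁻¹ *ᵥ y =
      A⁻¹ *ᵥ y - ((v ⬝ᵥ A⁻¹ *ᵥ y) / (1 + v ⬝ᵥ A⁻¹ *ᵥ v)) • A⁻¹ *ᵥ v := by
  have hu := hA.inv.posSemidef.quadForm_nonneg v
  set u := v ⬝ᵥ A⁻¹ *ᵥ v with hu'
  have h : (A + vecMulVec v v) *ᵥ
      (A⁻¹ *ᵥ y - ((v ⬝ᵥ A⁻¹ *ᵥ y) / (1 + u)) • A⁻¹ *ᵥ v) = y := by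
    simp only [add_mulVec, mulVec_sub, mulVec_smul, hA.mulVec_inv_mulVec, vecMulVec_mulVec,
      ← hu', op_smul_eq_smul]
    ext i
    simp only [Pi.add_apply, Pi.sub_apply, Pi.smul_apply, smul_eq_mul]
    field_simp
    ring
  conv_lhs => rw [← h]
  rw [(hA.add_vecMulVec v).inv_mulVec_mulVec]

/-- Sherman–Morrison. The increment is exactly the exponent in `mixtureFactor`, with `η` the noise
of the round. -/
theorem Matrix.PosDef.add_vecMulVec_inv_quadForm (hA : A.PosDef) (v b : n → ℝ) (η : ℝ) :
    (b + η • v) ⬝ᵥ (A + vecMulVec v v)⁻¹ *ᵥ (b + η • v) =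
      b ⬝ᵥ A⁻¹ *ᵥ b + (η ^ 2 * (v ⬝ᵥ A⁻¹ *ᵥ v) + 2 * η * (v ⬝ᵥ A⁻¹ *ᵥ b)
        - (v ⬝ᵥ A⁻¹ *ᵥ b) ^ 2) / (1 + v ⬝ᵥ A⁻¹ *ᵥ v) := by
  have hu := hA.inv.posSemidef.quadForm_nonneg v
  have hc := hA.inv.isHermitian.dotProduct_mulVec_comm b v
  rw [hA.add_vecMulVec_inv_mulVec]
  simp only [mulVec_add, mulVec_smul, dotProduct_add, add_dotProduct, smul_dotProduct,
    dotProduct_smul, smul_eq_mul, hc, dotProduct_sub]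
  field_simp
  ring

/-- Concavity of the logarithm on the eigenvalues (the inequality of arithmetic and geometric
means). -/
theorem Matrix.PosDef.log_det_le (hA : A.PosDef) :
    Real.log A.det ≤ Fintype.card n * Real.log (A.trace / Fintype.card n) := by
  rcases isEmpty_or_nonempty n with h | h
  · simp
  have hk : (0 : ℝ) < Fintype.card n := by exact_mod_cast Fintype.card_pos
  have hpos := hA.eigenvalues_pos
  have h1 : A.det = ∏ i, hA.isHermitian.eigenvalues i := by
    simpa using hA.isHermitian.det_eq_prod_eigenvalues
  have h2 : A.trace = ∑ i, hA.isHermitian.eigenvalues i := by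
    simpa using hA.isHermitian.trace_eq_sum_eigenvalues
  rw [h1, h2, Real.log_prod (fun i _ => (hpos i).ne')]
  have h3 := strictConcaveOn_log_Ioi.concaveOn.le_map_sum (t := Finset.univ)
    (w := fun _ : n => (Fintype.card n : ℝ)⁻¹) (p := hA.isHermitian.eigenvalues)
    (fun _ _ => by positivity) (by simp) (fun i _ => hpos i)
  simp only [smul_eq_mul, ← Finset.mul_sum] at h3
  rw [div_eq_inv_mul, ← div_le_iff₀' hk, div_eq_inv_mul]
  exact h3

end PosDef

/-! ### The weighted `1`-norm against the weighted `2`-norm. -/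

section Sqrt
variable {k : ℕ} {A : Matrix (Fin k) (Fin k) ℝ}

/-- In the coordinates `A^(1/2) x` the form is a plain sum of squares, so the two comparisons that
follow are those of the standard `1`- and `2`-norms. -/
theorem Matrix.PosSemidef.quadForm_eq_sum_sqrt (hA : A.PosSemidef) (x : Fin k → ℝ) :
    x ⬝ᵥ A *ᵥ x = ∑ i, (CFC.sqrt A *ᵥ x) i ^ 2 := by
  have h1 : CFC.sqrt A * CFC.sqrt A = A := CFC.sqrt_mul_sqrt_self A hA.nonneg
  have h2 : (CFC.sqrt A).IsHermitian := (CFC.sqrt_nonneg A).posSemidef.isHermitian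
  have h3 : (CFC.sqrt A)ᵀ = CFC.sqrt A := by
    simpa [conjTranspose_eq_transpose_of_trivial] using h2.eq
  conv_lhs => rw [← h1]
  rw [← mulVec_mulVec, dotProduct_mulVec, ← mulVec_transpose, h3]
  simp [dotProduct, sq]

theorem Matrix.PosSemidef.sqrt_quadForm_le_weightedL1Norm (hA : A.PosSemidef) (x : Fin k → ℝ) :
    √(x ⬝ᵥ A *ᵥ x) ≤ weightedL1Norm A x := by
  have h0 : 0 ≤ weightedL1Norm A x := Finset.sum_nonneg fun _ _ => abs_nonneg _
  rw [Real.sqrt_le_left h0, hA.quadForm_eq_sum_sqrt, weightedL1Norm]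
  simp_rw [← sq_abs ((CFC.sqrt A *ᵥ x) _)]
  exact Finset.sum_sq_le_sq_sum_of_nonneg fun i _ => abs_nonneg _

theorem Matrix.PosSemidef.weightedL1Norm_le (hA : A.PosSemidef) (x : Fin k → ℝ) :
    weightedL1Norm A x ≤ √(k * (x ⬝ᵥ A *ᵥ x)) := by
  apply Real.le_sqrt_of_sq_le
  rw [hA.quadForm_eq_sum_sqrt, weightedL1Norm]
  simpa using sq_sum_le_card_mul_sum_sq (s := Finset.univ) (f := fun i => |(CFC.sqrt A *ᵥ x) i|)

end Sqrt

/-! ### The design matrix, leverages and the elliptical potential. -/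

section Design
variable {k : ℕ} (p : ℕ → Fin k → ℝ)

theorem designMatrix_zero : designMatrix p 0 = 1 := by simp [designMatrix]

theorem designMatrix_succ (t : ℕ) :
    designMatrix p (t + 1) = designMatrix p t + vecMulVec (p t) (p t) := by
  simp [designMatrix, Finset.sum_range_succ, add_assoc]

theorem designMatrix_posDef (t : ℕ) : (designMatrix p t).PosDef := by
  induction t with
  | zero => rw [designMatrix_zero]; exact PosDef.one
  | succ t ih => rw [designMatrix_succ]; exact ih.add_vecMulVec _

/-- The squared dual norm of the direction played in round `t`. -/
def leverage (t : ℕ) : ℝ := p t ⬝ᵥ (designMatrix p t)⁻¹ *ᵥ p t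

theorem leverage_nonneg (t : ℕ) : 0 ≤ leverage p t :=
  (designMatrix_posDef p t).inv.posSemidef.quadForm_nonneg _

theorem designMatrix_quadForm (t : ℕ) (x : Fin k → ℝ) :
    x ⬝ᵥ designMatrix p t *ᵥ x = x ⬝ᵥ x + ∑ s ∈ Finset.range t, (p s ⬝ᵥ x) ^ 2 := by
  induction t with
  | zero => simp [designMatrix_zero]
  | succ t ih =>
    rw [designMatrix_succ, add_mulVec, dotProduct_add, ih, Finset.sum_range_succ, vecMulVec_mulVec,
      op_smul_eq_smul, dotProduct_smul, dotProduct_comm x (p t), smul_eq_mul]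
    ring

theorem designMatrix_inv_quadForm_le (t : ℕ) (x : Fin k → ℝ) :
    x ⬝ᵥ (designMatrix p t)⁻¹ *ᵥ x ≤ x ⬝ᵥ x := by
  have h := PosDef.one.inv_quadForm_le (designMatrix_posDef p t) (fun y => by
    rw [designMatrix_quadForm, one_mulVec]
    exact le_add_of_nonneg_right (Finset.sum_nonneg fun _ _ => sq_nonneg _)) x
  simpa using h

theorem det_designMatrix_succ (t : ℕ) :
    (designMatrix p (t + 1)).det = (designMatrix p t).det * (1 + leverage p t) := by
  rw [designMatrix_succ, (designMatrix_posDef p t).det_add_vecMulVec, leverage]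

theorem det_designMatrix_mono : Monotone fun t => (designMatrix p t).det := by
  refine monotone_nat_of_le_succ fun t => ?_
  rw [det_designMatrix_succ]
  exact le_mul_of_one_le_right (designMatrix_posDef p t).det_pos.le
    (le_add_of_nonneg_right (leverage_nonneg p t))

theorem one_le_det_designMatrix (t : ℕ) : 1 ≤ (designMatrix p t).det := by
  simpa [designMatrix_zero] using det_designMatrix_mono p (Nat.zero_le t)

theorem log_det_designMatrix (t : ℕ) :
    Real.log (designMatrix p t).det = ∑ s ∈ Finset.range t, Real.log (1 + leverage p s) := by
  induction t with
  | zero => simp [designMatrix_zero]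
  | succ t ih =>
    rw [det_designMatrix_succ, Real.log_mul (designMatrix_posDef p t).det_pos.ne'
      (by linarith [leverage_nonneg p t]), ih, Finset.sum_range_succ]

theorem log_det_designMatrix_le (t : ℕ) :
    Real.log (designMatrix p t).det ≤
      k * Real.log (1 + (∑ s ∈ Finset.range t, p s ⬝ᵥ p s) / k) := by
  rcases Nat.eq_zero_or_pos k with rfl | hk
  · simp
  have h := (designMatrix_posDef p t).log_det_le
  have htr : (designMatrix p t).trace = k + ∑ s ∈ Finset.range t, p s ⬝ᵥ p s := by
    simp [designMatrix, trace_sum, trace_vecMulVec]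
  have hk' : (k : ℝ) ≠ 0 := by positivity
  rwa [htr, Fintype.card_fin, add_div, div_self hk'] at h

/-- The chord of the concave function `log` between 1 and 2. It turns sums of leverages, which are
at most 1 here, into log-determinants. -/
theorem mul_log_two_le_log_one_add {x : ℝ} (h0 : 0 ≤ x) (h1 : x ≤ 1) :
    x * Real.log 2 ≤ Real.log (1 + x) := by
  have h := strictConcaveOn_log_Ioi.concaveOn.2 (x := 1) (y := 2) (by simp) (by simp)
    (sub_nonneg.2 h1) h0 (by ring)
  simp only [Real.log_one, smul_eq_mul, mul_zero, zero_add] at h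
  refine h.trans_eq ?_
  congr 1
  ring

end Design

/-! ### Ville's maximal inequality. -/

section Ville

/-- Ville's maximal inequality for a nonnegative supermartingale with values in `[0, ∞]`, over
finitely many rounds. -/
theorem mul_measure_exists_le_of_setLIntegral_antitone {Ω : Type*} {mΩ : MeasurableSpace Ω}
    {P : Measure Ω} {ℱ : Filtration ℕ mΩ} {M : ℕ → Ω → ℝ≥0∞} {T : ℕ}
    (hM : ∀ t ≤ T, Measurable[ℱ t] (M t))
    (hsuper : ∀ t < T, ∀ A, MeasurableSet[ℱ t] A → ∫⁻ ω in A, M (t + 1) ω ∂P ≤ ∫⁻ ω in A, M t ω ∂P)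
    (c : ℝ≥0∞) :
    c * P {ω | ∃ t ≤ T, c ≤ M t ω} ≤ ∫⁻ ω, M 0 ω ∂P := by
  have hmeas : ∀ t ≤ T + 1, MeasurableSet[ℱ (t - 1)] {ω | ∀ s < t, M s ω < c} := by
    intro t ht
    simp only [Set.ofPred_forall]
    refine MeasurableSet.iInter fun s => MeasurableSet.iInter fun hs => ?_
    exact measurableSet_lt ((hM s (by omega)).mono (ℱ.mono (by omega)) le_rfl) measurable_const
  -- The potential is `c` times the probability of having crossed before `t`, plus the integral of
  -- `M t` where no crossing has happened. Paths that cross at `t` move from the second term to the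
  -- first at price `c`, which is at most their value of `M t`.
  have hsplit : ∀ t ≤ T, c * P {ω | ∃ s < t + 1, c ≤ M s ω} +
      ∫⁻ ω in {ω | ∀ s < t + 1, M s ω < c}, M t ω ∂P ≤
      c * P {ω | ∃ s < t, c ≤ M s ω} + ∫⁻ ω in {ω | ∀ s < t, M s ω < c}, M t ω ∂P := by
    intro t ht
    have hC : MeasurableSet {ω | M t ω < c} :=
      measurableSet_lt ((hM t ht).mono (ℱ.le t) le_rfl) measurable_const
    have h1 := lintegral_inter_add_sdiff (μ := P) (M t) {ω | ∀ s < t, M s ω < c} hC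
    have h2 : {ω | ∀ s < t, M s ω < c} ∩ {ω | M t ω < c} = {ω | ∀ s < t + 1, M s ω < c} := by
      ext ω
      simp only [Set.mem_inter_iff, Set.mem_ofPred_eq, Nat.lt_succ_iff_lt_or_eq]
      constructor
      · rintro ⟨h, h'⟩ s (hs | rfl)
        exacts [h s hs, h']
      · exact fun h => ⟨fun s hs => h s (Or.inl hs), h t (Or.inr rfl)⟩
    rw [h2] at h1
    have h3 : c * P ({ω | ∀ s < t, M s ω < c} \ {ω | M t ω < c}) ≤
        ∫⁻ ω in {ω | ∀ s < t, M s ω < c} \ {ω | M t ω < c}, M t ω ∂P := by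
      rw [← setLIntegral_const]
      refine setLIntegral_mono' (((ℱ.le _) _ (hmeas t (by omega))).diff hC) fun ω hω => ?_
      exact not_lt.1 hω.2
    have h4 : {ω | ∃ s < t + 1, c ≤ M s ω} ⊆
        {ω | ∃ s < t, c ≤ M s ω} ∪ ({ω | ∀ s < t, M s ω < c} \ {ω | M t ω < c}) := by
      rintro ω ⟨s, hs, h⟩
      by_cases h' : ∃ s < t, c ≤ M s ω
      · exact Or.inl h'
      · push Not at h'
        refine Or.inr ⟨h', ?_⟩
        rcases Nat.lt_succ_iff_lt_or_eq.1 hs with hs | rfl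
        · exact absurd (h' s hs) (not_lt.2 h)
        · exact not_lt.2 h
    have h5 : c * P {ω | ∃ s < t + 1, c ≤ M s ω} ≤ c * P {ω | ∃ s < t, c ≤ M s ω} +
        c * P ({ω | ∀ s < t, M s ω < c} \ {ω | M t ω < c}) := by
      rw [← mul_add]
      gcongr
      exact (measure_mono h4).trans (measure_union_le _ _)
    calc _ ≤ c * P {ω | ∃ s < t, c ≤ M s ω} +
        ∫⁻ ω in {ω | ∀ s < t, M s ω < c} \ {ω | M t ω < c}, M t ω ∂P +
          ∫⁻ ω in {ω | ∀ s < t + 1, M s ω < c}, M t ω ∂P := by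
          gcongr
          exact h5.trans (by gcongr)
      _ = _ := by rw [← h1, add_assoc, add_comm (lintegral _ _) (lintegral _ _)]
  have hind : ∀ t ≤ T, c * P {ω | ∃ s < t, c ≤ M s ω} +
      ∫⁻ ω in {ω | ∀ s < t, M s ω < c}, M t ω ∂P ≤ ∫⁻ ω, M 0 ω ∂P := by
    intro t
    induction t with
    | zero => simp
    | succ t ih =>
      intro ht
      refine le_trans ?_ ((hsplit t (by omega)).trans (ih (by omega)))
      exact add_le_add le_rfl (hsuper t (by omega) _ (hmeas (t + 1) (by omega)))
  have h := (hsplit T le_rfl).trans (hind T le_rfl)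
  refine le_trans ?_ (le_self_add.trans h)
  simp

end Ville

/-! ### The conditional law of the observed reward. -/

section Disintegration

variable {Ω : Type*} {m mΩ : MeasurableSpace Ω} {P : Measure Ω}

/-- Restriction to `s` and the density `q` give the same measure on `m`, which is all that an
`m`-measurable integrand sees. Working with trimmed measures avoids any integrability assumption on
`H`. -/
theorem setLIntegral_eq_lintegral_condExp_mul [IsFiniteMeasure P] (hm : m ≤ mΩ) {s : Set Ω}
    (hs : MeasurableSet s) {q : Ω → ℝ} (hq : Measurable[m] q) (hq0 : ∀ ω, 0 ≤ q ω)
    (hP : P[s.indicator (fun _ => (1 : ℝ)) | m] =ᵐ[P] q) {H : Ω → ℝ≥0∞} (hH : Measurable[m] H) :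
    ∫⁻ ω in s, H ω ∂P = ∫⁻ ω, ENNReal.ofReal (q ω) * H ω ∂P := by
  have hqm : Measurable q := hq.mono hm le_rfl
  have hqi : Integrable q P := integrable_condExp.congr hP
  have h : (P.restrict s).trim hm = (P.withDensity fun ω => ENNReal.ofReal (q ω)).trim hm := by
    refine @Measure.ext _ m _ _ fun t ht => ?_
    rw [trim_measurableSet_eq hm ht, trim_measurableSet_eq hm ht,
      Measure.restrict_apply (hm t ht), withDensity_apply _ (hm t ht),
      ← ofReal_integral_eq_lintegral_ofReal hqi.integrableOn (Filter.Eventually.of_forall hq0)]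
    have h1 : ∫ ω in t, q ω ∂P = ∫ ω in t, s.indicator (fun _ => (1 : ℝ)) ω ∂P := by
      rw [← setIntegral_condExp hm ((integrable_const (1 : ℝ)).indicator hs) ht]
      exact (integral_congr_ae (ae_restrict_of_ae hP)).symm
    rw [h1, integral_indicator hs, Measure.restrict_restrict hs, setIntegral_const, smul_eq_mul,
      mul_one, Set.inter_comm, Measure.real, ENNReal.ofReal_toReal (measure_ne_top _ _)]
  rw [← lintegral_trim hm hH, h, lintegral_trim hm hH,
    lintegral_withDensity_eq_lintegral_mul _ (by fun_prop) (hH.mono hm le_rfl)]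
  rfl

theorem IndepFun.lintegral_prod {α β : Type*} {mα : MeasurableSpace α} {mβ : MeasurableSpace β}
    [IsProbabilityMeasure P] {f : Ω → α} {X : Ω → β} (hf : Measurable f) (hX : Measurable X)
    (h : IndepFun f X P) {g : α × β → ℝ≥0∞} (hg : Measurable g) :
    ∫⁻ ω, g (f ω, X ω) ∂P = ∫⁻ ω, ∫⁻ x, g (f ω, x) ∂(P.map X) ∂P := by
  have h1 := (indepFun_iff_map_prod_eq_prod_map_map hf.aemeasurable hX.aemeasurable).1 h
  have : IsProbabilityMeasure (P.map X) := Measure.isProbabilityMeasure_map hX.aemeasurable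
  rw [← lintegral_map hg (hf.prodMk hX), h1, MeasureTheory.lintegral_prod _ hg.aemeasurable,
    lintegral_map hg.lintegral_prod_right' hf]

theorem measurable_eval_pair {k : ℕ} :
    Measurable fun z : Fin k × (Fin k → ℝ) => z.2 z.1 :=
  measurable_from_prod_countable_right fun i => measurable_pi_apply i

theorem lintegral_rewardLaw {k : ℕ} (D : Measure (Fin k → ℝ)) (q : Fin k → ℝ) {f : ℝ → ℝ≥0∞}
    (hf : Measurable f) :
    ∫⁻ y, f y ∂(rewardLaw D q) = ∑ i, ENNReal.ofReal (q i) * ∫⁻ x, f (x i) ∂D := by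
  rw [rewardLaw, lintegral_finsetSum_measure]
  refine Finset.sum_congr rfl fun i _ => ?_
  rw [lintegral_smul_measure, lintegral_map hf (measurable_pi_apply i), smul_eq_mul]

/-- The conditional law of the observed reward given the past is `rewardLaw`. -/
theorem lintegral_observed_reward [IsProbabilityMeasure P] {k : ℕ} (hm : m ≤ mΩ)
    {X : Ω → Fin k → ℝ} {a : Ω → Fin k} {q : Ω → Fin k → ℝ} (hX : Measurable X)
    (ha : Measurable a) (hq : Measurable[m] q) (hq0 : ∀ ω i, 0 ≤ q ω i)
    (hlaw : ∀ i, P[(a ⁻¹' {i}).indicator (fun _ => (1 : ℝ)) | m] =ᵐ[P] fun ω => q ω i)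
    (hind : Indep (MeasurableSpace.comap X inferInstance)
      (m ⊔ MeasurableSpace.comap a inferInstance) P)
    {h : Ω × ℝ → ℝ≥0∞} (hh : Measurable[m.prod inferInstance] h) :
    ∫⁻ ω, h (ω, X ω (a ω)) ∂P = ∫⁻ ω, ∫⁻ y, h (ω, y) ∂(rewardLaw (P.map X) (q ω)) ∂P := by
  have hle : m ⊔ MeasurableSpace.comap a inferInstance ≤ mΩ := sup_le hm ha.comap_le
  have : IsProbabilityMeasure (P.map X) := Measure.isProbabilityMeasure_map hX.aemeasurable
  have hg : Measurable[(m ⊔ MeasurableSpace.comap a inferInstance).prod inferInstance]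
      fun z : Ω × (Fin k → ℝ) => h (z.1, z.2 (a z.1)) := by
    refine hh.comp ?_
    refine @Measurable.prodMk _ _ _ _ m _ _ _ ?_ ?_
    · exact (@measurable_fst Ω (Fin k → ℝ) (m ⊔ MeasurableSpace.comap a inferInstance) _).mono le_rfl
        le_sup_left
    · refine measurable_eval_pair.comp
        (@Measurable.prodMk _ (_) _ _ _ _ _ _ ?_ ?_)
      · have h1 : Measurable[m ⊔ MeasurableSpace.comap a inferInstance] a :=
          (comap_measurable a).mono le_sup_right le_rfl
        exact h1.comp (@measurable_fst Ω (Fin k → ℝ) (m ⊔ MeasurableSpace.comap a inferInstance) _)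
      · exact @measurable_snd Ω (Fin k → ℝ) (m ⊔ MeasurableSpace.comap a inferInstance) _
  have hindf : @IndepFun _ _ _ mΩ (m ⊔ MeasurableSpace.comap a inferInstance) _
      (id : Ω → Ω) X P := by
    rw [@IndepFun_iff_Indep _ _ _ mΩ (m ⊔ MeasurableSpace.comap a inferInstance),
      MeasurableSpace.comap_id]
    exact hind.symm
  have h1 := @IndepFun.lintegral_prod Ω mΩ P Ω (Fin k → ℝ)
    (m ⊔ MeasurableSpace.comap a inferInstance) _ _ id X (measurable_id'' hle) hX hindf _ hg
  simp only [id] at h1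
  rw [h1]
  have hH : ∀ i, Measurable[m] fun ω => ∫⁻ x, h (ω, x i) ∂(P.map X) := by
    intro i
    refine @Measurable.lintegral_prod_right' _ _ m _ _ _ (fun z : Ω × (Fin k → ℝ) => h (z.1, z.2 i))
      (hh.comp ?_)
    refine @Measurable.prodMk _ (_) _ _ m _ _ _ (@measurable_fst _ _ m _) ?_
    exact (measurable_pi_apply i).comp (@measurable_snd _ _ m _)
  -- The reward vector has been integrated out. Splitting by the arm drawn leaves integrands that
  -- depend on the past alone, so the conditional law of the arm can be used.
  have h2 : ∀ ω, ∫⁻ x, h (ω, x (a ω)) ∂(P.map X) =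
      ∑ i, (a ⁻¹' {i}).indicator (fun ω => ∫⁻ x, h (ω, x i) ∂(P.map X)) ω := by
    intro ω
    rw [Finset.sum_eq_single (a ω)]
    · simp
    · intro i _ hi
      exact Set.indicator_of_notMem (fun h' => hi h'.symm) _
    · simp
  have hfib : ∀ i, MeasurableSet (a ⁻¹' {i}) := fun i => ha (measurableSet_singleton i)
  simp_rw [h2]
  rw [lintegral_finsetSum _ fun i _ => ((hH i).mono hm le_rfl).indicator (hfib i)]
  have h3 : ∀ ω, ∫⁻ y, h (ω, y) ∂(rewardLaw (P.map X) (q ω)) =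
      ∑ i, ENNReal.ofReal (q ω i) * ∫⁻ x, h (ω, x i) ∂(P.map X) := fun ω =>
    lintegral_rewardLaw _ _ (hh.comp (@Measurable.prodMk _ _ _ _ m _ _ _
      (@measurable_const _ _ m _ _) measurable_id))
  simp_rw [h3]
  rw [lintegral_finsetSum]
  · refine Finset.sum_congr rfl fun i _ => ?_
    rw [lintegral_indicator (hfib i)]
    exact setLIntegral_eq_lintegral_condExp_mul hm (hfib i)
      ((measurable_pi_apply i).comp hq) (fun ω => hq0 ω i) (hlaw i) (hH i)
  · intro i _
    refine Measurable.mul ?_ ((hH i).mono hm le_rfl)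
    exact (((measurable_pi_apply i).comp hq).mono hm le_rfl).ennreal_ofReal

end Disintegration

/-! ### Linearizing a square by a Gaussian integral. -/

section Gaussian

theorem lintegral_exp_neg_mul_sub_sq {b : ℝ} (hb : 0 < b) (c : ℝ) :
    ∫⁻ x, ENNReal.ofReal (Real.exp (-b * (x - c) ^ 2)) = ENNReal.ofReal √(Real.pi / b) := by
  rw [lintegral_sub_right_eq_self (fun x => ENNReal.ofReal (Real.exp (-b * x ^ 2))) c,
    ← ofReal_integral_eq_lintegral_ofReal (integrable_exp_neg_mul_sq hb)
      (Filter.Eventually.of_forall fun _ => (Real.exp_pos _).le), integral_gaussian]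

/-- The one-step bound of the method of mixtures, for a sub-Gaussian noise. -/
theorem HasSubgaussianMGF.lintegral_exp_quadratic_le {ν : Measure ℝ} [SFinite ν] {c : ℝ}
    (hν : HasSubgaussianMGF (fun x => x - c) (1 / 2) ν) {u : ℝ} (hu : 0 ≤ u) (w : ℝ) :
    ∫⁻ y, ENNReal.ofReal
      (Real.exp (((y - c) ^ 2 * u + 2 * (y - c) * w - w ^ 2) / (1 + u))) ∂ν ≤
      ENNReal.ofReal √(1 + u) := by
  have hr : 0 < 1 + u := by linarith
  have hsq : √(1 + u) ^ 2 = 1 + u := Real.sq_sqrt hr.le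
  have hr' : 0 < √(1 + u) := Real.sqrt_pos.2 hr
  have hv : √u ^ 2 = u := Real.sq_sqrt hu
  have hpi : 0 < √Real.pi := Real.sqrt_pos.2 Real.pi_pos
  set r := √(1 + u)
  set v := √u
  have hmgf : ∀ l : ℝ, ∫⁻ y, ENNReal.ofReal (Real.exp (l * (y - c))) ∂ν ≤
      ENNReal.ofReal (Real.exp (l ^ 2 / 4)) := by
    intro l
    rw [← ofReal_integral_eq_lintegral_ofReal (hν.integrable_exp_mul l)
      (Filter.Eventually.of_forall fun _ => (Real.exp_pos _).le)]
    refine ENNReal.ofReal_le_ofReal ((hν.mgf_le l).trans_eq ?_)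
    congr 1
    push_cast
    ring
  -- The square in `y - c` is written as an integral over an auxiliary Gaussian variable `x`, using
  -- `2ab - a² = b² - (a - b)²`. For fixed `x` the exponent is then affine in `y - c`.
  have h1 : ∀ y, ENNReal.ofReal √Real.pi * ENNReal.ofReal
      (Real.exp (((y - c) ^ 2 * u + 2 * (y - c) * w - w ^ 2) / (1 + u))) =
      ∫⁻ x, ENNReal.ofReal (Real.exp (-x ^ 2 - w ^ 2 / (1 + u))) *
        ENNReal.ofReal (Real.exp ((2 * x * (v / r) + 2 * w / (1 + u)) * (y - c))) := by
    intro y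
    have h := lintegral_exp_neg_mul_sub_sq one_pos ((v / r) * (y - c))
    rw [div_one] at h
    rw [← h, mul_comm, ← lintegral_const_mul' _ _ ENNReal.ofReal_ne_top]
    congr 1 with x
    rw [← ENNReal.ofReal_mul (Real.exp_pos _).le, ← ENNReal.ofReal_mul (Real.exp_pos _).le,
      ← Real.exp_add, ← Real.exp_add]
    congr 2
    rw [← hsq]
    field_simp
    linear_combination (-(y - c) ^ 2) * hv
  have h2 : ENNReal.ofReal √Real.pi * ∫⁻ y, ENNReal.ofReal
      (Real.exp (((y - c) ^ 2 * u + 2 * (y - c) * w - w ^ 2) / (1 + u))) ∂ν ≤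
      ENNReal.ofReal √Real.pi * ENNReal.ofReal r := by
    rw [← lintegral_const_mul' _ _ ENNReal.ofReal_ne_top]
    simp_rw [h1]
    rw [lintegral_lintegral_swap (by fun_prop)]
    -- The moment bound is used at `λ = 2x(v/r) + 2w/(1+u)`. With variance proxy `1/2` the terms in
    -- `w` complete to a square exactly, and a shifted Gaussian of mass `√(π(1+u))` remains.
    calc _ ≤ ∫⁻ x : ℝ, ENNReal.ofReal (Real.exp (-x ^ 2 - w ^ 2 / (1 + u))) *
          ENNReal.ofReal (Real.exp ((2 * x * (v / r) + 2 * w / (1 + u)) ^ 2 / 4)) := by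
          refine lintegral_mono fun x => ?_
          rw [lintegral_const_mul' _ _ ENNReal.ofReal_ne_top]
          gcongr
          exact hmgf _
      _ = ∫⁻ x : ℝ, ENNReal.ofReal (Real.exp (-(1 / (1 + u)) * (x - w * v / r) ^ 2)) := by
          congr 1 with x
          rw [← ENNReal.ofReal_mul (Real.exp_pos _).le, ← Real.exp_add]
          congr 2
          rw [← hsq]
          have : v ^ 2 = r ^ 2 - 1 := by rw [hv, hsq]; ring
          field_simp
          ring_nf
          simp only [this]
          ring
      _ = _ := by
          rw [lintegral_exp_neg_mul_sub_sq (by positivity), ← ENNReal.ofReal_mul hpi.le,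
            ← Real.sqrt_mul Real.pi_pos.le, div_div_eq_mul_div, div_one]
  rwa [ENNReal.mul_le_mul_iff_right (by simpa using hpi) ENNReal.ofReal_ne_top] at h2

end Gaussian

/-! ### Measurability of determinants and inverses. -/

section Measurability

variable {Ω : Type*} {m : MeasurableSpace Ω} {n : Type*} [Fintype n]

theorem measurable_dotProduct {v w : Ω → n → ℝ} (hv : Measurable v) (hw : Measurable w) :
    Measurable fun ω => v ω ⬝ᵥ w ω := by
  simp only [dotProduct]
  fun_prop

variable [DecidableEq n]

theorem measurable_det {A : Ω → Matrix n n ℝ} (hA : ∀ i j, Measurable fun ω => A ω i j) :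
    Measurable fun ω => (A ω).det := by
  simp only [det_apply]
  refine Finset.measurable_sum _ fun σ _ => Measurable.const_smul ?_ _
  exact Finset.measurable_prod _ fun i _ => hA _ _

/-- Cramer's rule: an entry of the inverse is a quotient of determinants. -/
theorem measurable_inv_apply {A : Ω → Matrix n n ℝ} (hA : ∀ i j, Measurable fun ω => A ω i j)
    (i j : n) : Measurable fun ω => (A ω)⁻¹ i j := by
  have h : (fun ω => (A ω)⁻¹ i j) =
      fun ω => ((A ω).det)⁻¹ * ((A ω).updateRow j (Pi.single i 1)).det := by
    funext ω
    rw [inv_def, Matrix.smul_apply, Ring.inverse_eq_inv', smul_eq_mul, adjugate_apply]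
  rw [h]
  refine (measurable_det hA).inv.mul (measurable_det fun i' j' => ?_)
  by_cases h : i' = j
  · subst h
    simp
  · simp only [updateRow_ne h]
    exact hA _ _

theorem measurable_inv_mulVec {A : Ω → Matrix n n ℝ} (hA : ∀ i j, Measurable fun ω => A ω i j)
    {v : Ω → n → ℝ} (hv : Measurable v) : Measurable fun ω => (A ω)⁻¹ *ᵥ v ω := by
  refine measurable_pi_lambda _ fun i => ?_
  simp only [mulVec, dotProduct]
  refine Finset.measurable_sum _ fun j _ => (measurable_inv_apply hA i j).mul ?_
  exact (measurable_pi_apply j).comp hv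

theorem measurable_designMatrix_apply {k : ℕ} {p : ℕ → Ω → Fin k → ℝ} {t : ℕ}
    (hp : ∀ s < t, Measurable (p s)) (i j : Fin k) :
    Measurable fun ω => designMatrix (fun s => p s ω) t i j := by
  simp only [designMatrix, Matrix.add_apply, Matrix.sum_apply, vecMulVec_apply]
  refine measurable_const.add (Finset.measurable_sum _ fun s hs => ?_)
  have h := fun i => (measurable_pi_apply i).comp (hp s (Finset.mem_range.1 hs))
  exact (h i).mul (h j)

end Measurability

/-! ### The mixture supermartingale along a sequence. -/

section Mixture

variable {k : ℕ} (μ : Fin k → ℝ) (p : ℕ → Fin k → ℝ) (r : ℕ → ℝ)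

/-- The noise of the first `t` rewards, weighted by the distributions played. -/
def noiseSum (t : ℕ) : Fin k → ℝ := ∑ s ∈ Finset.range t, (r s - μ ⬝ᵥ p s) • p s

/-- The supermartingale of the method of mixtures. -/
def mixtureValue (t : ℕ) : ℝ :=
  Real.exp (noiseSum μ p r t ⬝ᵥ (designMatrix p t)⁻¹ *ᵥ noiseSum μ p r t) /
    √(designMatrix p t).det

theorem mixtureValue_zero : mixtureValue μ p r 0 = 1 := by
  simp [mixtureValue, noiseSum, designMatrix_zero]

theorem mixtureValue_nonneg (t : ℕ) : 0 ≤ mixtureValue μ p r t := by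
  rw [mixtureValue]; positivity

/-- The factor by which `mixtureValue` changes in a round with reward `y`, given the direction
`q`, its leverage `u` and its inner product `w` with the past noise. -/
def mixtureFactor (c u w y : ℝ) : ℝ :=
  Real.exp (((y - c) ^ 2 * u + 2 * (y - c) * w - w ^ 2) / (1 + u)) / √(1 + u)

theorem mixtureValue_succ (t : ℕ) :
    mixtureValue μ p r (t + 1) = mixtureValue μ p r t *
      mixtureFactor (μ ⬝ᵥ p t) (leverage p t)
        (p t ⬝ᵥ (designMatrix p t)⁻¹ *ᵥ noiseSum μ p r t) (r t) := by
  have h := (designMatrix_posDef p t).add_vecMulVec_inv_quadForm (p t) (noiseSum μ p r t)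
    (r t - μ ⬝ᵥ p t)
  have hs : noiseSum μ p r (t + 1) = noiseSum μ p r t + (r t - μ ⬝ᵥ p t) • p t := by
    rw [noiseSum, Finset.sum_range_succ, noiseSum]
  rw [mixtureValue, mixtureValue, mixtureFactor, det_designMatrix_succ, hs,
    designMatrix_succ, h, Real.exp_add, Real.sqrt_mul (designMatrix_posDef p t).det_pos.le,
    mul_div_mul_comm]
  rfl

theorem noiseSum_quadForm_le {t : ℕ} {δ : ℝ} (hδ : 0 < δ)
    (h : mixtureValue μ p r t < 1 / δ) :
    noiseSum μ p r t ⬝ᵥ (designMatrix p t)⁻¹ *ᵥ noiseSum μ p r t ≤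
      Real.log (designMatrix p t).det / 2 + Real.log (1 / δ) := by
  have hdet := (designMatrix_posDef p t).det_pos
  have hs := Real.sqrt_pos.2 hdet
  rw [mixtureValue, div_lt_iff₀ hs] at h
  rw [← Real.log_sqrt hdet.le, add_comm, ← Real.log_mul (by positivity) hs.ne',
    Real.le_log_iff_exp_le (by positivity)]
  exact h.le

end Mixture

/-! ### Concentration of the noise in a run. -/

section Concentration

variable {k : ℕ} {C : Set (Fin k → ℝ)} {μ : Fin k → ℝ} {σ δ : ℝ} {T : ℕ}
  {D : Measure (Fin k → ℝ)} {Ω : Type*} {mΩ : MeasurableSpace Ω} {P : Measure Ω}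
  {ℱ : Filtration ℕ mΩ} {X : ℕ → Ω → Fin k → ℝ} {a : ℕ → Ω → Fin k} {p : ℕ → Ω → Fin k → ℝ}

instance isFiniteMeasure_rewardLaw [IsFiniteMeasure D] (q : Fin k → ℝ) :
    IsFiniteMeasure (rewardLaw D q) := by
  unfold rewardLaw
  have (i : Fin k) : IsFiniteMeasure (ENNReal.ofReal (q i) • D.map fun x => x i) :=
    Measure.smul_finite _ ENNReal.ofReal_ne_top
  infer_instance

theorem IsL1OFULRun.measurable_noiseSum (h : IsL1OFULRun C σ δ T D P ℱ X a p) {t : ℕ}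
    (ht : t ≤ T) :
    Measurable[ℱ t] fun ω => noiseSum μ (fun s => p s ω) (fun s => X s ω (a s ω)) t := by
  simp only [noiseSum]
  refine Finset.measurable_fun_sum _ fun s hs => ?_
  have hs' := Finset.mem_range.1 hs
  have hp : Measurable[ℱ t] (p s) :=
    (h.measurable_dist s (by omega)).mono (ℱ.mono hs'.le) le_rfl
  have hr : Measurable[ℱ t] fun ω => X s ω (a s ω) :=
    (h.measurable_obs s (by omega)).mono (ℱ.mono hs') le_rfl
  exact (hr.sub (measurable_dotProduct measurable_const hp)).smul hp

theorem IsL1OFULRun.measurable_designMatrix (h : IsL1OFULRun C σ δ T D P ℱ X a p) {t : ℕ}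
    (ht : t ≤ T) (i j : Fin k) :
    Measurable[ℱ t] fun ω => designMatrix (fun s => p s ω) t i j :=
  @measurable_designMatrix_apply _ (ℱ t) _ _ _ (fun s hs =>
    (h.measurable_dist s (by omega)).mono (ℱ.mono hs.le) le_rfl) i j

theorem IsL1OFULRun.measurable_mixtureValue (h : IsL1OFULRun C σ δ T D P ℱ X a p) {t : ℕ}
    (ht : t ≤ T) :
    Measurable[ℱ t] fun ω => mixtureValue μ (fun s => p s ω) (fun s => X s ω (a s ω)) t := by
  have h1 := h.measurable_noiseSum (μ := μ) ht
  have h2 := h.measurable_designMatrix ht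
  exact (measurable_dotProduct h1 (measurable_inv_mulVec h2 h1)).exp.div (measurable_det h2).sqrt

/-- Given the past, the new factor depends only on the reward, whose law is `rewardLaw D (p t ω)`.
As `p t ω` is a vertex, the sub-Gaussian assumption applies, and the one-step bound cancels the
factor `√(1 + leverage)` coming from the determinant. -/
theorem IsL1OFULRun.setLIntegral_mixtureValue_succ_le [IsProbabilityMeasure P]
    (h : IsL1OFULRun C σ δ T D P ℱ X a p) (hC : C ⊆ stdSimplex ℝ (Fin k))
    (hD : IsSubgaussianReward C μ (1 / 2) D) {t : ℕ} (ht : t < T) {A : Set Ω}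
    (hA : MeasurableSet[ℱ t] A) :
    ∫⁻ ω in A, ENNReal.ofReal
      (mixtureValue μ (fun s => p s ω) (fun s => X s ω (a s ω)) (t + 1)) ∂P ≤
    ∫⁻ ω in A, ENNReal.ofReal
      (mixtureValue μ (fun s => p s ω) (fun s => X s ω (a s ω)) t) ∂P := by
  have hA' : MeasurableSet A := ℱ.le t _ hA
  have hpC : ∀ ω, p t ω ∈ C := fun ω => ((h.plays ω t ht).1).1
  have hZ := h.measurable_mixtureValue (μ := μ) ht.le
  have hN := h.measurable_noiseSum (μ := μ) ht.le
  have hV := h.measurable_designMatrix ht.le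
  have hp := h.measurable_dist t ht
  have hc : Measurable[ℱ t] fun ω => μ ⬝ᵥ p t ω := measurable_dotProduct measurable_const hp
  have hu : Measurable[ℱ t] fun ω => leverage (fun s => p s ω) t :=
    measurable_dotProduct hp (measurable_inv_mulVec hV hp)
  have hw : Measurable[ℱ t] fun ω => p t ω ⬝ᵥ (designMatrix (fun s => p s ω) t)⁻¹ *ᵥ
      noiseSum μ (fun s => p s ω) (fun s => X s ω (a s ω)) t :=
    measurable_dotProduct hp (measurable_inv_mulVec hV hN)
  have ha : Measurable (a t) := (h.measurable_arm t ht).mono (ℱ.le _) le_rfl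
  have : IsProbabilityMeasure D := by
    rw [← h.reward_law t ht]
    exact Measure.isProbabilityMeasure_map (h.measurable_reward t ht).aemeasurable
  have hG : Measurable[(ℱ t).prod inferInstance] fun z : Ω × ℝ => A.indicator
      (fun ω => ENNReal.ofReal
        (mixtureValue μ (fun s => p s ω) (fun s => X s ω (a s ω)) t)) z.1 *
      ENNReal.ofReal (mixtureFactor (μ ⬝ᵥ p t z.1) (leverage (fun s => p s z.1) t)
        (p t z.1 ⬝ᵥ (designMatrix (fun s => p s z.1) t)⁻¹ *ᵥ
          noiseSum μ (fun s => p s z.1) (fun s => X s z.1 (a s z.1)) t) z.2) := by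
    have hf := @measurable_fst Ω ℝ (ℱ t) inferInstance
    have hy := @measurable_snd Ω ℝ (ℱ t) inferInstance
    have h0 : Measurable[ℱ t] (A.indicator fun ω => ENNReal.ofReal
        (mixtureValue μ (fun s => p s ω) (fun s => X s ω (a s ω)) t)) :=
      hZ.ennreal_ofReal.indicator hA
    have h1 := h0.comp hf
    have hc' := hc.comp hf
    have hu' := hu.comp hf
    have hw' := hw.comp hf
    refine h1.mul (Measurable.ennreal_ofReal ?_)
    unfold mixtureFactor
    refine Measurable.div (Measurable.exp (Measurable.div ?_ (hu'.const_add 1)))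
      (hu'.const_add 1).sqrt
    exact ((((hy.sub hc').pow_const 2).mul hu').add (((hy.sub hc').const_mul 2).mul hw')).sub
      (hw'.pow_const 2)
  have key := lintegral_observed_reward (ℱ.le t) (h.measurable_reward t ht) ha hp
    (fun ω i => (hC (hpC ω)).1 i) (h.arm_law t ht) (h.indep t ht) hG
  rw [← lintegral_indicator hA', ← lintegral_indicator hA']
  calc _ = _ := by
        congr 1 with ω
        by_cases hω : ω ∈ A
        · rw [Set.indicator_of_mem hω, mixtureValue_succ,
            ENNReal.ofReal_mul (mixtureValue_nonneg _ _ _ _), Set.indicator_of_mem hω]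
        · simp [Set.indicator_of_notMem hω]
    _ = _ := key
    _ ≤ _ := by
        refine lintegral_mono fun ω => ?_
        by_cases hω : ω ∈ A
        swap
        · simp [Set.indicator_of_notMem hω]
        simp only [Set.indicator_of_mem hω]
        rw [lintegral_const_mul' _ _ ENNReal.ofReal_ne_top, h.reward_law t ht]
        refine mul_le_of_le_one_right (by positivity) ?_
        have hlev := leverage_nonneg (fun s => p s ω) t
        have hs : 0 < √(1 + leverage (fun s => p s ω) t) := Real.sqrt_pos.2 (by linarith)
        have h1 := HasSubgaussianMGF.lintegral_exp_quadratic_le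
          (hD.subgaussian _ (h.plays ω t ht).1) hlev
          (p t ω ⬝ᵥ (designMatrix (fun s => p s ω) t)⁻¹ *ᵥ
            noiseSum μ (fun s => p s ω) (fun s => X s ω (a s ω)) t)
        simp only [mixtureFactor, div_eq_mul_inv (Real.exp _) (√_)]
        simp_rw [ENNReal.ofReal_mul (Real.exp_pos _).le]
        rw [lintegral_mul_const' _ _ ENNReal.ofReal_ne_top]
        refine (mul_le_mul_left h1 _).trans_eq ?_
        rw [← ENNReal.ofReal_mul hs.le, mul_inv_cancel₀ hs.ne', ENNReal.ofReal_one]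

theorem IsL1OFULRun.measure_exists_mixtureValue_le [IsProbabilityMeasure P]
    (h : IsL1OFULRun C σ δ T D P ℱ X a p) (hC : C ⊆ stdSimplex ℝ (Fin k))
    (hD : IsSubgaussianReward C μ (1 / 2) D) (hδ : 0 < δ) :
    P {ω | ∃ t ≤ T, 1 / δ ≤ mixtureValue μ (fun s => p s ω) (fun s => X s ω (a s ω)) t} ≤
      ENNReal.ofReal δ := by
  have h1 := mul_measure_exists_le_of_setLIntegral_antitone (P := P) (ℱ := ℱ) (T := T)
    (M := fun t ω => ENNReal.ofReal
      (mixtureValue μ (fun s => p s ω) (fun s => X s ω (a s ω)) t))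
    (fun t ht => (h.measurable_mixtureValue ht).ennreal_ofReal)
    (fun t ht A hA => h.setLIntegral_mixtureValue_succ_le hC hD ht hA)
    (ENNReal.ofReal (1 / δ))
  simp only [mixtureValue_zero, ENNReal.ofReal_one, lintegral_const, measure_univ, mul_one,
    ENNReal.ofReal_le_ofReal_iff (mixtureValue_nonneg _ _ _ _)] at h1
  calc _ = ENNReal.ofReal δ * (ENNReal.ofReal (1 / δ) * P {ω | ∃ t ≤ T,
        1 / δ ≤ mixtureValue μ (fun s => p s ω) (fun s => X s ω (a s ω)) t}) := by
        rw [← mul_assoc, ← ENNReal.ofReal_mul hδ.le, mul_one_div_cancel hδ.ne', ENNReal.ofReal_one,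
          one_mul]
    _ ≤ ENNReal.ofReal δ * 1 := mul_le_mul_right h1 _
    _ = _ := mul_one _

end Concentration

/-! ### Linear functionals and gaps on the polytope. -/

section Polytope

variable {k g : ℕ} {C : Set (Fin k → ℝ)} {μ vstar : Fin k → ℝ}

theorem fairPolytope_subset_stdSimplex (G : Fin g → Finset (Fin k)) (l u : Fin g → ℝ) :
    fairPolytope G l u ⊆ stdSimplex ℝ (Fin k) := fun _ hp => hp.1

theorem fairPolytope_eq (G : Fin g → Finset (Fin k)) (l u : Fin g → ℝ) :
    fairPolytope G l u =
      stdSimplex ℝ (Fin k) ∩ ⋂ i, (fun p => ∑ a ∈ G i, p a) ⁻¹' Set.Icc (l i) (u i) := by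
  ext p
  simp [fairPolytope]

theorem isCompact_fairPolytope (G : Fin g → Finset (Fin k)) (l u : Fin g → ℝ) :
    IsCompact (fairPolytope G l u) := by
  rw [fairPolytope_eq]
  exact (isCompact_stdSimplex ℝ (Fin k)).inter_right
    (isClosed_iInter fun i => isClosed_Icc.preimage (by fun_prop))

theorem convex_fairPolytope (G : Fin g → Finset (Fin k)) (l u : Fin g → ℝ) :
    Convex ℝ (fairPolytope G l u) := by
  rw [fairPolytope_eq]
  refine (convex_stdSimplex ℝ (Fin k)).inter (convex_iInter fun i => ?_)
  refine (convex_Icc (l i) (u i)).is_linear_preimage (f := fun p : Fin k → ℝ => ∑ a ∈ G i, p a) ?_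
  exact ⟨fun x y => by simp [Finset.sum_add_distrib], fun c x => by simp [Finset.mul_sum]⟩

theorem continuous_dotProduct_left (μ : Fin k → ℝ) : Continuous fun q => μ ⬝ᵥ q := by
  simp only [dotProduct]
  fun_prop

/-- Krein–Milman: a closed half-space that contains the vertices contains `C`. -/
theorem IsBestVertex.dotProduct_le (h : IsBestVertex C μ vstar) (hc : IsCompact C)
    (hconv : Convex ℝ C) {q : Fin k → ℝ} (hq : q ∈ C) : μ ⬝ᵥ q ≤ μ ⬝ᵥ vstar := by
  have h1 : closure (convexHull ℝ (vertices C)) = C := closure_convexHull_extremePoints hc hconv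
  have h2 : closure (convexHull ℝ (vertices C)) ⊆ {q | μ ⬝ᵥ q ≤ μ ⬝ᵥ vstar} := by
    refine closure_minimal (convexHull_min h.2 ?_)
      (isClosed_le (continuous_dotProduct_left μ) continuous_const)
    exact convex_halfSpace_le ⟨fun x y => dotProduct_add _ _ _, fun c x => dotProduct_smul _ _ _⟩ _
  rw [h1] at h2
  exact h2 hq

theorem IsBestVertex.sSup_eq (h : IsBestVertex C μ vstar) (hc : IsCompact C)
    (hconv : Convex ℝ C) : sSup ((fun q => μ ⬝ᵥ q) '' C) = μ ⬝ᵥ vstar := by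
  refine IsGreatest.csSup_eq ⟨⟨vstar, h.1.1, rfl⟩, ?_⟩
  rintro _ ⟨q, hq, rfl⟩
  exact h.dotProduct_le hc hconv hq

theorem IsBestVertex.vertexGap_le (h : IsBestVertex C μ vstar) {v : Fin k → ℝ}
    (hv : v ∈ vertices C) (hne : v ≠ vstar) : vertexGap C μ vstar ≤ μ ⬝ᵥ vstar - μ ⬝ᵥ v := by
  have h1 : BddAbove ((fun v => μ ⬝ᵥ v) '' (vertices C \ {vstar})) := by
    refine ⟨μ ⬝ᵥ vstar, ?_⟩
    rintro _ ⟨w, hw, rfl⟩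
    exact h.2 w hw.1
  have h2 := le_csSup h1 ⟨v, ⟨hv, hne⟩, rfl⟩
  rw [vertexGap]
  simp only at h2
  linarith

theorem dotProduct_self_le_one_of_mem_stdSimplex {q : Fin k → ℝ} (hq : q ∈ stdSimplex ℝ (Fin k)) :
    q ⬝ᵥ q ≤ 1 := by
  rw [← hq.2]
  refine Finset.sum_le_sum fun i _ => ?_
  have h1 : q i ≤ 1 := hq.2 ▸ Finset.single_le_sum (fun j _ => hq.1 j) (Finset.mem_univ i)
  exact mul_le_of_le_one_right (hq.1 i) h1

theorem dotProduct_self_le_sq {μ : Fin k → ℝ} {σ : ℝ}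
    (h : ‖(WithLp.toLp 2 μ : EuclideanSpace ℝ (Fin k))‖ ≤ σ) : μ ⬝ᵥ μ ≤ σ ^ 2 := by
  have h1 : μ ⬝ᵥ μ = ‖(WithLp.toLp 2 μ : EuclideanSpace ℝ (Fin k))‖ ^ 2 := by
    rw [EuclideanSpace.norm_sq_eq]
    simp [dotProduct, sq]
  rw [h1]
  exact pow_le_pow_left₀ (norm_nonneg _) h 2

/-- The gap between two points of the simplex is at most `√2 * σ`. -/
theorem sq_dotProduct_sub_le {σ : ℝ} (hμ : μ ⬝ᵥ μ ≤ σ ^ 2) {v w : Fin k → ℝ}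
    (hv : v ∈ stdSimplex ℝ (Fin k)) (hw : w ∈ stdSimplex ℝ (Fin k)) :
    (μ ⬝ᵥ v - μ ⬝ᵥ w) ^ 2 ≤ 2 * σ ^ 2 := by
  have h1 := PosDef.one.dotProduct_sq_le μ (v - w)
  have h2 : (v - w) ⬝ᵥ (v - w) ≤ 2 := by
    have h3 : 0 ≤ v ⬝ᵥ w := Finset.sum_nonneg fun i _ => mul_nonneg (hv.1 i) (hw.1 i)
    have h4 := dotProduct_self_le_one_of_mem_stdSimplex hv
    have h5 := dotProduct_self_le_one_of_mem_stdSimplex hw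
    simp only [dotProduct_sub, sub_dotProduct, dotProduct_comm w v]
    linarith
  have h0 : 0 ≤ (v - w) ⬝ᵥ (v - w) := Finset.sum_nonneg fun i _ => mul_self_nonneg _
  simp only [one_mulVec, inv_one, dotProduct_sub μ] at h1
  refine h1.trans ?_
  rw [mul_comm]
  exact mul_le_mul h2 hμ (Finset.sum_nonneg fun i _ => mul_self_nonneg _) zero_le_two

end Polytope

/-! ### Confidence ellipsoids and optimism. -/

section Confidence

variable {k : ℕ} {C : Set (Fin k → ℝ)} {μ vstar : Fin k → ℝ} {p : ℕ → Fin k → ℝ} {r : ℕ → ℝ}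
  {σ δ : ℝ}

theorem estimate_eq (t : ℕ) :
    estimate p r t = μ + (designMatrix p t)⁻¹ *ᵥ (noiseSum μ p r t - μ) := by
  have h : ∑ s ∈ Finset.range t, r s • p s =
      designMatrix p t *ᵥ μ + (noiseSum μ p r t - μ) := by
    simp only [designMatrix, noiseSum, add_mulVec, one_mulVec, sum_mulVec, vecMulVec_mulVec,
      op_smul_eq_smul, sub_smul, Finset.sum_sub_distrib, dotProduct_comm μ]
    abel
  rw [estimate, h, mulVec_add, (designMatrix_posDef p t).inv_mulVec_mulVec]

theorem Matrix.PosDef.sqrt_quadForm_sub_le {A : Matrix (Fin k) (Fin k) ℝ} (hA : A.PosDef)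
    (x y : Fin k → ℝ) :
    (x - y) ⬝ᵥ A *ᵥ (x - y) ≤ (√(x ⬝ᵥ A *ᵥ x) + √(y ⬝ᵥ A *ᵥ y)) ^ 2 := by
  have h1 := hA.posSemidef.dotProduct_mulVec_sq_le x y
  have hx := hA.posSemidef.quadForm_nonneg x
  have hy := hA.posSemidef.quadForm_nonneg y
  have h2 : -(x ⬝ᵥ A *ᵥ y) ≤ √(x ⬝ᵥ A *ᵥ x) * √(y ⬝ᵥ A *ᵥ y) := by
    rw [← Real.sqrt_mul hx]
    exact Real.le_sqrt_of_sq_le (by simpa using h1)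
  have h3 := hA.isHermitian.dotProduct_mulVec_comm y x
  simp only [mulVec_sub, dotProduct_sub, sub_dotProduct, h3]
  rw [add_sq, Real.sq_sqrt hx, Real.sq_sqrt hy]
  linarith

/-- The radius of the confidence ellipsoid before round `t`. -/
def confRadius (σ δ : ℝ) (p : ℕ → Fin k → ℝ) (t : ℕ) : ℝ :=
  √(Real.log (designMatrix p t).det + Real.log (1 / δ)) + σ

theorem confWidth_eq (hδ : 0 < δ) (t : ℕ) : confWidth σ δ p t = confRadius σ δ p t ^ 2 := by
  have h := (designMatrix_posDef p t).det_pos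
  rw [confWidth, confRadius, Real.log_rpow (by positivity), Real.log_div h.ne' hδ.ne',
    Real.log_div one_ne_zero hδ.ne', Real.log_one]
  congr 3
  ring

theorem confRadius_nonneg (hσ : 0 ≤ σ) (t : ℕ) : 0 ≤ confRadius σ δ p t := by
  rw [confRadius]; positivity

theorem confRadius_mono : Monotone (confRadius σ δ p) := by
  intro s t hst
  rw [confRadius, confRadius]
  have h := det_designMatrix_mono p hst
  have h' := (designMatrix_posDef p s).det_pos
  gcongr

theorem sqrt_confWidth (hσ : 0 ≤ σ) (hδ : 0 < δ) (t : ℕ) :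
    √(k * confWidth σ δ p t) = √k * confRadius σ δ p t := by
  rw [confWidth_eq hδ, Real.sqrt_mul (by positivity), Real.sqrt_sq (confRadius_nonneg hσ t)]

/-- The error is `V⁻¹` applied to the noise sum minus the regularization bias `μ`, and the triangle
inequality separates the two. The half on the log-determinant is given up to match the algorithm's
width. -/
theorem estimate_error_le (hσ : 0 ≤ σ) (hμ : μ ⬝ᵥ μ ≤ σ ^ 2) {t : ℕ}
    (h : noiseSum μ p r t ⬝ᵥ (designMatrix p t)⁻¹ *ᵥ noiseSum μ p r t ≤
      Real.log (designMatrix p t).det / 2 + Real.log (1 / δ)) :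
    (estimate p r t - μ) ⬝ᵥ designMatrix p t *ᵥ (estimate p r t - μ) ≤
      confRadius σ δ p t ^ 2 := by
  have hV := designMatrix_posDef p t
  have h1 := hV.inv.sqrt_quadForm_sub_le (noiseSum μ p r t) μ
  rw [estimate_eq (μ := μ), add_sub_cancel_left, hV.mulVec_inv_mulVec, dotProduct_comm]
  refine h1.trans ?_
  rw [confRadius]
  have h2 := Real.log_nonneg (one_le_det_designMatrix p t)
  gcongr
  · linarith
  · exact Real.sqrt_le_iff.2 ⟨hσ, (designMatrix_inv_quadForm_le p t μ).trans hμ⟩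

theorem Matrix.PosDef.dotProduct_le_sqrt_mul_sqrt {A : Matrix (Fin k) (Fin k) ℝ} (hA : A.PosDef)
    (x y : Fin k → ℝ) : x ⬝ᵥ y ≤ √(x ⬝ᵥ A *ᵥ x) * √(y ⬝ᵥ A⁻¹ *ᵥ y) := by
  rw [← Real.sqrt_mul (hA.posSemidef.quadForm_nonneg x)]
  exact Real.le_sqrt_of_sq_le (hA.dotProduct_sq_le x y)

/-- The regret of an optimistic choice, in terms of its dual norm. -/
theorem regret_le_of_optimistic (hσ : 0 ≤ σ) (hδ : 0 < δ) (hμ : μ ⬝ᵥ μ ≤ σ ^ 2) {t : ℕ}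
    (h : noiseSum μ p r t ⬝ᵥ (designMatrix p t)⁻¹ *ᵥ noiseSum μ p r t ≤
      Real.log (designMatrix p t).det / 2 + Real.log (1 / δ)) {q : Fin k → ℝ}
    (hopt : optimisticValue (confSet σ δ p r t) q ≤ optimisticValue (confSet σ δ p r t) (p t)) :
    μ ⬝ᵥ q - μ ⬝ᵥ p t ≤ (√k + 1) * confRadius σ δ p t * √(leverage p t) := by
  have hV := designMatrix_posDef p t
  have hR := confRadius_nonneg (p := p) (δ := δ) hσ t
  have herr := estimate_error_le hσ hμ h
  -- The factor `√k` in the radius of the `1`-norm ball pays for passing from the `2`-norm to the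
  -- `1`-norm.
  have hmem : μ ∈ confSet σ δ p r t := by
    refine (hV.posSemidef.weightedL1Norm_le _).trans (Real.sqrt_le_sqrt ?_)
    rw [confWidth_eq hδ, ← neg_sub (estimate p r t) μ, mulVec_neg, neg_dotProduct,
      dotProduct_neg, neg_neg]
    gcongr
  have hub : ∀ x : Fin k → ℝ, ∀ m ∈ confSet σ δ p r t, m ⬝ᵥ x ≤ estimate p r t ⬝ᵥ x +
      √k * confRadius σ δ p t * √(x ⬝ᵥ (designMatrix p t)⁻¹ *ᵥ x) := by
    intro x m hm
    have h1 := hV.dotProduct_le_sqrt_mul_sqrt (m - estimate p r t) x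
    have h2 : √((m - estimate p r t) ⬝ᵥ designMatrix p t *ᵥ (m - estimate p r t)) ≤
        √k * confRadius σ δ p t := by
      rw [← sqrt_confWidth hσ hδ]
      exact (hV.posSemidef.sqrt_quadForm_le_weightedL1Norm _).trans hm
    have h3 := mul_le_mul_of_nonneg_right h2
      (Real.sqrt_nonneg (x ⬝ᵥ (designMatrix p t)⁻¹ *ᵥ x))
    rw [sub_dotProduct] at h1
    linarith
  have hlow : μ ⬝ᵥ q ≤ optimisticValue (confSet σ δ p r t) q := by
    refine le_csSup ⟨estimate p r t ⬝ᵥ q +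
      √k * confRadius σ δ p t * √(q ⬝ᵥ (designMatrix p t)⁻¹ *ᵥ q), ?_⟩ ⟨μ, hmem, rfl⟩
    rintro _ ⟨m, hm, rfl⟩
    exact hub q m hm
  have hup : optimisticValue (confSet σ δ p r t) (p t) ≤ estimate p r t ⬝ᵥ p t +
      √k * confRadius σ δ p t * √(leverage p t) := by
    refine csSup_le ⟨_, μ, hmem, rfl⟩ ?_
    rintro _ ⟨m, hm, rfl⟩
    exact hub (p t) m hm
  -- The true `μ` lies in the undilated ellipsoid, hence `√k + 1` in the conclusion and not `2√k`.
  have h4 := hV.dotProduct_le_sqrt_mul_sqrt (estimate p r t - μ) (p t)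
  have h5 : √((estimate p r t - μ) ⬝ᵥ designMatrix p t *ᵥ (estimate p r t - μ)) ≤
      confRadius σ δ p t := Real.sqrt_le_iff.2 ⟨hR, herr⟩
  have h6 := mul_le_mul_of_nonneg_right h5 (Real.sqrt_nonneg (leverage p t))
  rw [sub_dotProduct] at h4
  have h7 : √(p t ⬝ᵥ (designMatrix p t)⁻¹ *ᵥ p t) = √(leverage p t) := rfl
  rw [h7] at h4
  linarith

end Confidence

/-! ### Erasing the best vertex and the self-bounding regret inequality. -/

section Regret

variable {k : ℕ} {C : Set (Fin k → ℝ)} {μ vstar : Fin k → ℝ} {p : ℕ → Fin k → ℝ} {r : ℕ → ℝ}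
  {σ δ γ : ℝ} {T : ℕ}

open Classical in
/-- The sequence `p` with the plays of `v` replaced by `0`. -/
def eraseVertex (p : ℕ → Fin k → ℝ) (v : Fin k → ℝ) (t : ℕ) : Fin k → ℝ :=
  if p t = v then 0 else p t

open Classical in
/-- The number of the first `T` rounds in which `v` is not played. -/
def otherPlays (p : ℕ → Fin k → ℝ) (v : Fin k → ℝ) (T : ℕ) : ℕ :=
  ((Finset.range T).filter fun t => p t ≠ v).card

theorem otherPlays_le (p : ℕ → Fin k → ℝ) (v : Fin k → ℝ) (T : ℕ) : otherPlays p v T ≤ T := by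
  simpa [otherPlays] using Finset.card_filter_le (Finset.range T) _

theorem otherPlays_succ (p : ℕ → Fin k → ℝ) (v : Fin k → ℝ) (T : ℕ) [Decidable (p T = v)] :
    otherPlays p v (T + 1) = otherPlays p v T + if p T = v then 0 else 1 := by
  classical
  rw [otherPlays, otherPlays, Finset.range_add_one, Finset.filter_insert]
  by_cases h : p T = v <;> simp [h]

theorem designMatrix_eq_eraseVertex (p : ℕ → Fin k → ℝ) (v : Fin k → ℝ) (T : ℕ) :
    designMatrix p T = designMatrix (eraseVertex p v) T +
      ((T : ℝ) - otherPlays p v T) • vecMulVec v v := by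
  classical
  induction T with
  | zero => simp [designMatrix_zero, otherPlays]
  | succ T ih =>
    rw [designMatrix_succ, designMatrix_succ, ih, otherPlays_succ, eraseVertex]
    by_cases h : p T = v
    · simp only [h, if_true]
      push_cast
      rw [show vecMulVec (0 : Fin k → ℝ) 0 = 0 by ext; simp [vecMulVec_apply]]
      module
    · simp only [h, if_false]
      push_cast
      module

/-- All erased plays form a single rank-one term, so by the determinant lemma they contribute one
logarithm, with no factor `k`. -/
theorem log_det_designMatrix_le_eraseVertex (p : ℕ → Fin k → ℝ) {v : Fin k → ℝ}
    (hv : v ⬝ᵥ v ≤ 1) (T : ℕ) :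
    Real.log (designMatrix p T).det ≤
      Real.log (1 + (T - otherPlays p v T)) +
        Real.log (designMatrix (eraseVertex p v) T).det := by
  have hA := designMatrix_posDef (eraseVertex p v) T
  have hM : (0 : ℝ) ≤ T - otherPlays p v T := by
    rw [sub_nonneg]; exact_mod_cast otherPlays_le p v T
  have h0 := hA.inv.posSemidef.quadForm_nonneg v
  have h1 := (designMatrix_inv_quadForm_le (eraseVertex p v) T v).trans hv
  rw [designMatrix_eq_eraseVertex p v, hA.det_add_smul_vecMulVec, add_comm (Real.log _),
    ← Real.log_mul hA.det_pos.ne' (by positivity)]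
  have := hA.det_pos
  gcongr
  exact mul_le_of_le_one_right hM h1

theorem sum_eraseVertex_le {v : Fin k → ℝ} (hp : ∀ t < T, p t ⬝ᵥ p t ≤ 1) :
    ∑ t ∈ Finset.range T, eraseVertex p v t ⬝ᵥ eraseVertex p v t ≤ otherPlays p v T := by
  classical
  rw [otherPlays, Finset.card_filter, Nat.cast_sum]
  refine Finset.sum_le_sum fun t ht => ?_
  rw [eraseVertex]
  by_cases h : p t = v
  · simp [h]
  · simpa [h] using hp t (Finset.mem_range.1 ht)

/-- Erasure removes positive semidefinite terms from the design, and inversion reverses the order.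
-/
theorem leverage_le_eraseVertex {v : Fin k → ℝ} {t : ℕ} (h : p t ≠ v) :
    leverage p t ≤ leverage (eraseVertex p v) t := by
  have h1 : eraseVertex p v t = p t := by simp [eraseVertex, h]
  rw [leverage, leverage, h1]
  refine (designMatrix_posDef _ t).inv_quadForm_le (designMatrix_posDef p t) (fun x => ?_) _
  rw [designMatrix_quadForm, designMatrix_quadForm]
  refine add_le_add le_rfl (Finset.sum_le_sum fun s _ => ?_)
  by_cases hs : p s = v
  · simp only [eraseVertex, hs, if_true, zero_dotProduct]
    nlinarith [sq_nonneg (v ⬝ᵥ x)]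
  · simp [eraseVertex, hs]

theorem sum_leverage_mul_log_two_le (hp : ∀ t < T, p t ⬝ᵥ p t ≤ 1) :
    (∑ t ∈ Finset.range T, leverage p t) * Real.log 2 ≤ Real.log (designMatrix p T).det := by
  rw [log_det_designMatrix, Finset.sum_mul]
  refine Finset.sum_le_sum fun t ht => mul_log_two_le_log_one_add (leverage_nonneg p t) ?_
  exact (designMatrix_inv_quadForm_le p t _).trans (hp t (Finset.mem_range.1 ht))

/-- The regret bound of L1-OFUL on the event that the noise is controlled, through the
log-determinant of the design matrix of the suboptimal plays only. -/
theorem fairRegret_bounds (hC : C ⊆ stdSimplex ℝ (Fin k)) (hc : IsCompact C) (hconv : Convex ℝ C)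
    (hσ : 0 ≤ σ) (hμ : μ ⬝ᵥ μ ≤ σ ^ 2) (hδ : 0 < δ) (hbest : IsBestVertex C μ vstar)
    (hγ : γ = vertexGap C μ vstar) (hplays : IsL1OFULSequence C σ δ T p r)
    (hnoise : ∀ t < T, noiseSum μ p r t ⬝ᵥ (designMatrix p t)⁻¹ *ᵥ noiseSum μ p r t ≤
      Real.log (designMatrix p t).det / 2 + Real.log (1 / δ)) :
    γ * otherPlays p vstar T ≤ fairRegret C μ p T ∧
    γ * fairRegret C μ p T ≤ (√k + 1) ^ 2 / Real.log 2 *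
      (√(Real.log (designMatrix p T).det + Real.log (1 / δ)) + σ) ^ 2 *
      Real.log (designMatrix (eraseVertex p vstar) T).det := by
  classical
  have hle : ∀ t < T, μ ⬝ᵥ p t ≤ μ ⬝ᵥ vstar := fun t ht => hbest.2 _ (hplays t ht).1
  have hgap : ∀ t < T, p t ≠ vstar → γ ≤ μ ⬝ᵥ vstar - μ ⬝ᵥ p t := fun t ht h =>
    hγ ▸ hbest.vertexGap_le (hplays t ht).1 h
  have hp : ∀ t < T, p t ⬝ᵥ p t ≤ 1 := fun t ht =>
    dotProduct_self_le_one_of_mem_stdSimplex (hC (hplays t ht).1.1)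
  rw [fairRegret, hbest.sSup_eq hc hconv]
  constructor
  · rw [otherPlays, Finset.card_filter, Nat.cast_sum, Finset.mul_sum]
    refine Finset.sum_le_sum fun t ht => ?_
    have ht' := Finset.mem_range.1 ht
    by_cases h : p t = vstar
    · simp [h]
    · simpa [h] using hgap t ht' h
  · have hp' : ∀ t < T, eraseVertex p vstar t ⬝ᵥ eraseVertex p vstar t ≤ 1 := by
      intro t ht
      by_cases h : p t = vstar
      · simp [eraseVertex, h]
      · simpa [eraseVertex, h] using hp t ht
    have hsum := sum_leverage_mul_log_two_le hp'
    have hlog := Real.log_pos one_lt_two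
    rw [← le_div_iff₀ hlog] at hsum
    -- In a suboptimal round `γ Δ ≤ Δ²`, which replaces the square root of the leverage by the
    -- leverage itself. Rounds that play `vstar` have no regret.
    have hround : ∀ t < T, γ * (μ ⬝ᵥ vstar - μ ⬝ᵥ p t) ≤
        (√k + 1) ^ 2 * confRadius σ δ p T ^ 2 * leverage (eraseVertex p vstar) t := by
      intro t ht
      have hlev := leverage_nonneg (eraseVertex p vstar) t
      by_cases h : p t = vstar
      · rw [h, sub_self, mul_zero]
        positivity
      · have h0 := sub_nonneg.2 (hle t ht)
        have h1 := regret_le_of_optimistic hσ hδ hμ (hnoise t ht)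
          ((hplays t ht).2 vstar hbest.1.1)
        have h2 : confRadius σ δ p t ≤ confRadius σ δ p T := confRadius_mono ht.le
        have h3 := confRadius_nonneg (p := p) (δ := δ) hσ t
        calc γ * (μ ⬝ᵥ vstar - μ ⬝ᵥ p t) ≤ (μ ⬝ᵥ vstar - μ ⬝ᵥ p t) ^ 2 := by
              rw [sq]
              exact mul_le_mul_of_nonneg_right (hgap t ht h) h0
          _ ≤ ((√k + 1) * confRadius σ δ p t * √(leverage p t)) ^ 2 :=
              pow_le_pow_left₀ h0 h1 2
          _ = (√k + 1) ^ 2 * confRadius σ δ p t ^ 2 * leverage p t := by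
              rw [mul_pow, mul_pow, Real.sq_sqrt (leverage_nonneg p t)]
          _ ≤ _ := by
              have := leverage_nonneg p t
              gcongr
              exact leverage_le_eraseVertex h
    calc γ * ∑ t ∈ Finset.range T, (μ ⬝ᵥ vstar - μ ⬝ᵥ p t)
        ≤ (√k + 1) ^ 2 * confRadius σ δ p T ^ 2 *
          ∑ t ∈ Finset.range T, leverage (eraseVertex p vstar) t := by
          rw [Finset.mul_sum, Finset.mul_sum]
          exact Finset.sum_le_sum fun t ht => hround t (Finset.mem_range.1 ht)
      _ ≤ (√k + 1) ^ 2 * confRadius σ δ p T ^ 2 *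
          (Real.log (designMatrix (eraseVertex p vstar) T).det / Real.log 2) := by gcongr
      _ = _ := by rw [confRadius]; ring

theorem log_det_eraseVertex_le {v : Fin k → ℝ} (hp : ∀ t < T, p t ⬝ᵥ p t ≤ 1) :
    Real.log (designMatrix (eraseVertex p v) T).det ≤
      k * Real.log (1 + otherPlays p v T / k) := by
  refine (log_det_designMatrix_le _ T).trans ?_
  have h0 : 0 ≤ ∑ t ∈ Finset.range T, eraseVertex p v t ⬝ᵥ eraseVertex p v t :=
    Finset.sum_nonneg fun t _ => Finset.sum_nonneg fun i _ => mul_self_nonneg _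
  gcongr
  exact sum_eraseVertex_le hp

theorem log_det_le_of_norm_le_one (hp : ∀ t < T, p t ⬝ᵥ p t ≤ 1) :
    Real.log (designMatrix p T).det ≤ k * Real.log (1 + T / k) := by
  refine (log_det_designMatrix_le _ T).trans ?_
  have h0 : 0 ≤ ∑ t ∈ Finset.range T, p t ⬝ᵥ p t :=
    Finset.sum_nonneg fun t _ => Finset.sum_nonneg fun i _ => mul_self_nonneg _
  gcongr
  refine (Finset.sum_le_sum fun t ht => hp t (Finset.mem_range.1 ht)).trans ?_
  simp

end Regret

/-! ### Numerical inequalities for the explicit bound. -/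

section Estimates

theorem eighteen_tenths_le_log : (1.8 : ℝ) ≤ Real.log 6.65 := by
  have h1 : (13 : ℝ) * Real.log 2 ≤ 5 * Real.log 6.65 := by
    have h : Real.log ((2 : ℝ) ^ 13) ≤ Real.log ((6.65 : ℝ) ^ 5) :=
      Real.log_le_log (by norm_num) (by norm_num)
    rwa [Real.log_pow, Real.log_pow] at h
  linarith [Real.log_two_gt_d9]

theorem four_fifths_le_two_mul_log : (0.8 : ℝ) ≤ 2 * Real.log (3 / 2) := by
  have h1 : Real.log ((2 : ℝ) ^ 7) ≤ Real.log ((3 / 2 : ℝ) ^ 12) :=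
    Real.log_le_log (by norm_num) (by norm_num)
  rw [Real.log_pow, Real.log_pow] at h1
  push_cast at h1
  linarith [Real.log_two_gt_d9]

theorem sqrt_two_le : √2 ≤ (1.41422 : ℝ) := by
  rw [Real.sqrt_le_left (by norm_num)]; norm_num

/-- The ratio of the left side to `k` is largest at `k = 2`, and `0.7253` is chosen just above what
that case needs. -/
theorem sqrt_add_one_sq_le {k : ℝ} (hk : 2 ≤ k) :
    (√k + 1) ^ 2 / Real.log 2 ≤ 8 * k * 0.7253 ^ 2 := by
  have hl := Real.log_two_gt_d9
  have h2 : 0 < √2 := by positivity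
  have h1 : √k ≤ k * (√2 / 2) := by
    rw [Real.sqrt_le_left (by positivity), mul_pow, div_pow, Real.sq_sqrt zero_le_two]
    nlinarith
  rw [div_le_iff₀ (by linarith), add_sq, Real.sq_sqrt (by linarith)]
  have h3 := sqrt_two_le
  have h4 : k + 2 * √k * 1 + 1 ^ 2 ≤ k * (1.5 + 1.41422) := by nlinarith
  refine h4.trans ?_
  rw [show 8 * k * 0.7253 ^ 2 * Real.log 2 = k * (8 * 0.7253 ^ 2 * Real.log 2) by ring]
  gcongr
  norm_num
  linarith

theorem mul_log_one_add_div_mono {a : ℝ} (ha : 0 ≤ a) {x y : ℝ} (hx : 0 < x) (hxy : x ≤ y) :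
    x * Real.log (1 + a / x) ≤ y * Real.log (1 + a / y) := by
  have hy : 0 < y := hx.trans_le hxy
  have h := strictConcaveOn_log_Ioi.concaveOn.2 (x := 1) (y := 1 + a / x) (by simp)
    (by simp only [Set.mem_Ioi]; positivity)
    (sub_nonneg.2 ((div_le_one hy).2 hxy)) (by positivity : 0 ≤ x / y) (by ring)
  simp only [Real.log_one, smul_eq_mul, mul_zero, zero_add] at h
  have h2 : (1 - x / y) * 1 + x / y * (1 + a / x) = 1 + a / y := by field_simp; ring
  rw [h2] at h
  calc _ = y * (x / y * Real.log (1 + a / x)) := by field_simp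
    _ ≤ _ := by gcongr

theorem mul_log_one_add_div_le {k T : ℝ} (hk : 0 < k) (hT : 1 ≤ T) :
    k * Real.log (1 + T / k) ≤ k * Real.log T + 1 := by
  have h1 : Real.log (1 + T / k) ≤ Real.log T + Real.log (1 + 1 / k) := by
    rw [← Real.log_mul (by positivity) (by positivity)]
    refine Real.log_le_log (by positivity) ?_
    rw [mul_add, mul_one, mul_one_div]
    linarith
  have h2 := Real.log_le_sub_one_of_pos (show 0 < 1 + 1 / k by positivity)
  have h3 : k * Real.log (1 + T / k) ≤ k * (Real.log T + (1 + 1 / k - 1)) := by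
    gcongr; linarith
  refine h3.trans_eq ?_
  field_simp
  ring

/-- The explicit regret bound for small horizons. -/
theorem regretFactor_le_of_le_four {k τ Y l s E : ℝ} (hk : 2 ≤ k) (hτ : 0 ≤ τ) (hY1 : 0.8 ≤ Y)
    (hY4 : Y ≤ 4) (hl : 0 ≤ l) (hs : 1 / 2 ≤ s) (hEY : E ≤ Y) {D : ℝ} (hDY : D ≤ Y) :
    0.7253 * (√(D + l) + 1) * √E ≤
      τ + (k - 1) * Real.log (64 * s * (Y + 2 * l) ^ 2) + 2 * l := by
  have hsY : √Y ^ 2 = Y := Real.sq_sqrt (by linarith)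
  have hsYl : √(Y + l) ^ 2 = Y + l := Real.sq_sqrt (by linarith)
  have h1 : 0.7253 * (√(D + l) + 1) * √E ≤ 0.7253 * (√(Y + l) + 1) * √Y := by gcongr
  have h2 : √(Y + l) * √Y ≤ Y + l / 2 := by nlinarith [sq_nonneg (√(Y + l) - √Y)]
  have h3 : √Y ≤ (Y + 1) / 2 := by nlinarith [sq_nonneg (√Y - 1)]
  have h4 : 5 * Real.log 2 + 2 * Real.log Y ≤ Real.log (64 * s * (Y + 2 * l) ^ 2) := by
    have h : Real.log (2 ^ 5 * Y ^ 2) ≤ Real.log (64 * s * (Y + 2 * l) ^ 2) := by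
      refine Real.log_le_log (by positivity) ?_
      gcongr
      · linarith
      · linarith
    rwa [Real.log_mul (by norm_num) (by positivity), Real.log_pow, Real.log_pow] at h
  have h5 : 1 - Y⁻¹ ≤ Real.log Y := Real.one_sub_inv_le_log_of_pos (by linarith)
  have h6 : Y * Y⁻¹ = 1 := mul_inv_cancel₀ (by linarith)
  have hl2 := Real.log_two_gt_d9
  -- After multiplication by `Y` this is a convex quadratic inequality that holds on `[0.8, 4]`. For
  -- such `Y` the bound on `N` is not needed.
  have h7 : 1.088 * Y + 0.363 ≤ 5.465 - 2 * Y⁻¹ := by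
    have hYpos : 0 < Y := by linarith
    refine le_of_mul_le_mul_left ?_ hYpos
    nlinarith
  have h8 : 0 ≤ Real.log (64 * s * (Y + 2 * l) ^ 2) := by linarith
  have h9 : Real.log (64 * s * (Y + 2 * l) ^ 2) ≤
      (k - 1) * Real.log (64 * s * (Y + 2 * l) ^ 2) := le_mul_of_one_le_left h8 (by linarith)
  have h10 : 0.7253 * (√(Y + l) + 1) * √Y ≤ 0.7253 * (1.5 * Y + 0.5 + l / 2) := by
    rw [mul_assoc, add_mul, one_mul]
    refine mul_le_mul_of_nonneg_left ?_ (by norm_num)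
    linarith only [h2, h3]
  linarith only [h1, h10, h4, h5, h7, h9, hl2, hτ, hl, hY1]

/-- The explicit regret bound for large horizons. -/
theorem regretFactor_le_of_four_le {k τ Y l s E D N : ℝ} (hk : 2 ≤ k) (hτ : 0 ≤ τ)
    (hY4 : 4 ≤ Y) (hl : 0 ≤ l) (hs : 1 / 2 ≤ s) (hE0 : 0 ≤ E) (hEY : E ≤ Y) (hD0 : 0 ≤ D)
    (hDY : D ≤ Y) (hN : 0 ≤ N) (hEN : E ≤ k * Real.log (1 + N / k)) (hYτ : Y ≤ k * τ + 1)
    (hDE : D ≤ τ + E)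
    (hND : N ≤ 8 * k * s * (0.7253 * (√(D + l) + 1) * √E) ^ 2) :
    0.7253 * (√(D + l) + 1) * √E ≤
      τ + (k - 1) * Real.log (64 * s * (Y + 2 * l) ^ 2) + 2 * l := by
  have hsY : √Y ^ 2 = Y := Real.sq_sqrt (by linarith)
  have hsYl : √(Y + l) ^ 2 = Y + l := Real.sq_sqrt (by linarith)
  have h1 : 0.7253 * (√(D + l) + 1) * √E ≤ 0.7253 * (√(Y + l) + 1) * √Y := by gcongr
  have h2 : √(Y + l) * √Y ≤ Y + l / 2 := by nlinarith [sq_nonneg (√(Y + l) - √Y)]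
  have h3 : √Y ≤ Y / 2 := by rw [Real.sqrt_le_left (by linarith)]; nlinarith
  have h4 : 0.7253 * (√(D + l) + 1) * √E ≤ 0.7253 * 1.5 * (Y + 2 * l) := by
    refine h1.trans ?_
    rw [mul_assoc, mul_assoc, add_mul, one_mul]
    refine mul_le_mul_of_nonneg_left ?_ (by norm_num)
    linarith only [h2, h3, hl]
  have h5 : N / k ≤ 8 * s * (0.7253 * 1.5 * (Y + 2 * l)) ^ 2 := by
    rw [div_le_iff₀ (by linarith)]
    calc N ≤ _ := hND
      _ ≤ 8 * k * s * (0.7253 * 1.5 * (Y + 2 * l)) ^ 2 := by gcongr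
      _ = _ := by ring
  -- Since `s ≥ 1/2` and `Y ≥ 4`, the product `s (Y + 2l)²` is at least 8. The gap between `8
  -- (0.7253 · 1.5)²` and `64 / 6.65` then absorbs the summand 1; dividing by `6.65` saves `1.8` in
  -- the logarithm.
  have h6 : 1 + N / k ≤ 64 * s * (Y + 2 * l) ^ 2 / 6.65 := by
    have h7 : (16 : ℝ) ≤ (Y + 2 * l) ^ 2 := by nlinarith
    have h8 : 1 / 2 * 16 ≤ s * (Y + 2 * l) ^ 2 := by gcongr
    have h9 : 64 * s * (Y + 2 * l) ^ 2 / 6.65 = 64 / 6.65 * (s * (Y + 2 * l) ^ 2) := by ring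
    have h10 : 8 * s * (0.7253 * 1.5 * (Y + 2 * l)) ^ 2 =
        8 * (0.7253 * 1.5) ^ 2 * (s * (Y + 2 * l) ^ 2) := by ring
    rw [h9]
    rw [h10] at h5
    norm_num at h5 ⊢
    linarith
  have hN' : 0 ≤ N / k := by positivity
  have h7 : Real.log (1 + N / k) ≤ Real.log (64 * s * (Y + 2 * l) ^ 2) - 1.8 := by
    have h8 := Real.log_le_log (by positivity) h6
    rw [Real.log_div (by positivity) (by norm_num)] at h8
    linarith [eighteen_tenths_le_log]
  have h8 : 0 ≤ Real.log (1 + N / k) := Real.log_nonneg (by linarith)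
  obtain ⟨Λ, hΛ⟩ : ∃ Λ, Λ = Real.log (64 * s * (Y + 2 * l) ^ 2) - 1.8 := ⟨_, rfl⟩
  rw [← hΛ] at h7
  have hΛ0 : 0 ≤ Λ := h8.trans h7
  have h9 : E ≤ k * Λ := hEN.trans (by gcongr)
  -- A convex combination of the two bounds `E ≤ kτ + 1` and `E ≤ kΛ`, with weight `0.778 / k` on
  -- the first. After the factor `0.7253 · 1.125` below, the coefficient of `τ` stays below 1 and
  -- that of `Λ` below `k - 1`, also at `k = 2`.
  have h10 : E ≤ 0.778 * τ + 0.389 + (k - 0.778) * Λ := by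
    have hE1 := mul_le_mul_of_nonneg_left (hEY.trans hYτ) (by positivity : 0 ≤ 0.778 / k)
    have hE2 := mul_le_mul_of_nonneg_left h9
      (sub_nonneg.2 ((div_le_one (by linarith)).2 (by linarith)) : 0 ≤ 1 - 0.778 / k)
    have e1 : 0.778 / k * (k * τ + 1) = 0.778 * τ + 0.778 / k := by field_simp
    have e2 : (1 - 0.778 / k) * (k * Λ) = (k - 0.778) * Λ := by field_simp
    have e3 : 0.778 / k ≤ 0.389 := by rw [div_le_iff₀ (by linarith)]; linarith
    linarith
  have hsE : √E ^ 2 = E := Real.sq_sqrt hE0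
  have hsDl : √(D + l) ^ 2 = D + l := Real.sq_sqrt (by linarith)
  have h11 : √(D + l) * √E ≤ τ / 2 + E + l / 2 := by nlinarith [sq_nonneg (√(D + l) - √E)]
  -- The tangent at `E = 16`. The additive constants that result are covered by `1.8 (k - 1)`.
  have h12 : √E ≤ E / 8 + 2 := by nlinarith [sq_nonneg (√E - 4)]
  have h13 : Real.log (64 * s * (Y + 2 * l) ^ 2) = Λ + 1.8 := by rw [hΛ]; ring
  rw [h13]
  have h14 : 0 ≤ (k - 2) * Λ := mul_nonneg (by linarith) hΛ0
  have h15 : 0.7253 * (√(D + l) + 1) * √E ≤ 0.7253 * (τ / 2 + 1.125 * E + l / 2 + 2) := by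
    rw [mul_assoc, add_mul, one_mul]
    refine mul_le_mul_of_nonneg_left ?_ (by norm_num)
    linarith only [h11, h12]
  refine h15.trans ?_
  linarith only [h10, h14, hΛ0, hk, hτ, hl]

end Estimates

/-! ### The explicit and the asymptotic regret bound along a sequence. -/

section ExplicitBound

variable {k : ℕ} {C : Set (Fin k → ℝ)} {μ vstar : Fin k → ℝ} {p : ℕ → Fin k → ℝ} {r : ℕ → ℝ}
  {σ δ γ : ℝ} {T : ℕ}

theorem one_le_of_mem_stdSimplex {v : Fin k → ℝ} (hv : v ∈ stdSimplex ℝ (Fin k)) : 1 ≤ k := by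
  rcases Nat.eq_zero_or_pos k with rfl | h
  · simpa using hv.2
  · exact h

theorem two_le_of_ne_of_mem_stdSimplex {v w : Fin k → ℝ} (hv : v ∈ stdSimplex ℝ (Fin k))
    (hw : w ∈ stdSimplex ℝ (Fin k)) (hne : v ≠ w) : 2 ≤ k := by
  by_contra! h
  have h1 : k = 1 := by have := one_le_of_mem_stdSimplex hv; omega
  subst h1
  apply hne
  ext i
  have hv2 := hv.2
  have hw2 := hw.2
  simp only [Fin.sum_univ_one] at hv2 hw2
  rw [Subsingleton.elim i 0, hv2, hw2]

theorem otherPlays_pos_iff {v : Fin k → ℝ} : 0 < otherPlays p v T ↔ ∃ t < T, p t ≠ v := by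
  classical
  rw [otherPlays, Finset.card_pos]
  constructor
  · rintro ⟨t, ht⟩
    rw [Finset.mem_filter, Finset.mem_range] at ht
    exact ⟨t, ht⟩
  · rintro ⟨t, ht⟩
    exact ⟨t, by rwa [Finset.mem_filter, Finset.mem_range]⟩

theorem fairRegret_le_explicit (hC : C ⊆ stdSimplex ℝ (Fin k)) (hc : IsCompact C)
    (hconv : Convex ℝ C) (hσ : 1 ≤ σ) (hμ : μ ⬝ᵥ μ ≤ σ ^ 2) (hδ : 0 < δ) (hδ1 : δ < 1)
    (hbest : IsBestVertex C μ vstar) (hγ : γ = vertexGap C μ vstar) (hγ0 : 0 < γ)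
    (hplays : IsL1OFULSequence C σ δ T p r)
    (hnoise : ∀ t < T, noiseSum μ p r t ⬝ᵥ (designMatrix p t)⁻¹ *ᵥ noiseSum μ p r t ≤
      Real.log (designMatrix p t).det / 2 + Real.log (1 / δ)) :
    fairRegret C μ p T ≤ 8 * k * σ ^ 2 / γ *
      (Real.log T + (k - 1) * Real.log (64 * σ ^ 2 / γ ^ 2)
        + 2 * (k - 1) * Real.log (k * Real.log (1 + T / k) + 2 * Real.log (1 / δ))
        + 2 * Real.log (1 / δ)) ^ 2 := by
  have hp : ∀ t < T, p t ⬝ᵥ p t ≤ 1 := fun t ht =>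
    dotProduct_self_le_one_of_mem_stdSimplex (hC (hplays t ht).1.1)
  obtain ⟨hN, hR⟩ := fairRegret_bounds hC hc hconv (by linarith) hμ hδ hbest hγ hplays hnoise
  have hE := log_det_eraseVertex_le (v := vstar) hp
  have hD := log_det_le_of_norm_le_one hp
  have hDE := log_det_designMatrix_le_eraseVertex p
    (dotProduct_self_le_one_of_mem_stdSimplex (hC hbest.1.1)) T
  have hE0 := Real.log_nonneg (one_le_det_designMatrix (eraseVertex p vstar) T)
  have hD0 := Real.log_nonneg (one_le_det_designMatrix p T)
  have hl : 0 ≤ Real.log (1 / δ) := Real.log_nonneg (by rw [le_div_iff₀ hδ]; linarith)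
  rw [← le_div_iff₀' hγ0] at hR
  -- Without suboptimal plays `E = 0` and the regret is at most 0. Otherwise two distinct points of
  -- the simplex exist, which gives `k ≥ 2` and `γ² ≤ 2σ²`.
  rcases Nat.eq_zero_or_pos (otherPlays p vstar T) with h0 | hpos
  · rw [h0] at hE
    simp only [Nat.cast_zero, zero_div, add_zero, Real.log_one, mul_zero] at hE
    rw [le_antisymm hE hE0, mul_zero, zero_div] at hR
    exact hR.trans (by positivity)
  obtain ⟨t, ht, hne⟩ := otherPlays_pos_iff.1 hpos
  have hk : (2 : ℝ) ≤ k := by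
    exact_mod_cast two_le_of_ne_of_mem_stdSimplex (hC (hplays t ht).1.1) (hC hbest.1.1) hne
  have hT : (1 : ℝ) ≤ T := by
    have : 1 ≤ T := by omega
    exact_mod_cast this
  have hγσ : γ ^ 2 ≤ 2 * σ ^ 2 := by
    refine le_trans ?_ (sq_dotProduct_sub_le hμ (hC hbest.1.1) (hC (hplays t ht).1.1))
    exact pow_le_pow_left₀ hγ0.le (hγ ▸ hbest.vertexGap_le (hplays t ht).1 hne) 2
  have hs : 1 / 2 ≤ σ ^ 2 / γ ^ 2 := by
    rw [div_le_div_iff₀ two_pos (by positivity)]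
    linarith
  have hNle : (otherPlays p vstar T : ℝ) ≤ T := by exact_mod_cast otherPlays_le p vstar T
  have hN1 : (1 : ℝ) ≤ otherPlays p vstar T := by exact_mod_cast hpos
  set N : ℝ := (otherPlays p vstar T : ℝ)
  set E := Real.log (designMatrix (eraseVertex p vstar) T).det
  set D := Real.log (designMatrix p T).det
  set l := Real.log (1 / δ)
  set Y := (k : ℝ) * Real.log (1 + T / k) with hY
  have hEY : E ≤ Y := hE.trans (by rw [hY]; gcongr)
  have hDE' : D ≤ Real.log T + E := by
    refine hDE.trans (add_le_add (Real.log_le_log (by linarith) (by linarith)) le_rfl)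
  have hY8 : 0.8 ≤ Y := by
    refine four_fifths_le_two_mul_log.trans ?_
    refine le_trans ?_ (mul_log_one_add_div_mono (by linarith : (0 : ℝ) ≤ T) two_pos hk)
    gcongr
    linarith
  have hYτ : Y ≤ k * Real.log T + 1 := mul_log_one_add_div_le (by linarith) hT
  have hτ : 0 ≤ Real.log T := Real.log_nonneg hT
  have hγR : γ * fairRegret C μ p T ≤
      8 * k * σ ^ 2 * (0.7253 * (√(D + l) + 1) * √E) ^ 2 := by
    rw [le_div_iff₀' hγ0] at hR
    refine hR.trans ?_
    calc (√k + 1) ^ 2 / Real.log 2 * (√(D + l) + σ) ^ 2 * E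
        ≤ 8 * k * 0.7253 ^ 2 * (σ * (√(D + l) + 1)) ^ 2 * E := by
          have h1 : √(D + l) + σ ≤ σ * (√(D + l) + 1) := by
            nlinarith [Real.sqrt_nonneg (D + l)]
          gcongr
          exact sqrt_add_one_sq_le hk
      _ = _ := by
          rw [mul_pow _ (√E), mul_pow _ (√(D + l) + 1), Real.sq_sqrt hE0]
          ring
  have hND : N ≤ 8 * k * (σ ^ 2 / γ ^ 2) * (0.7253 * (√(D + l) + 1) * √E) ^ 2 := by
    have h1 : γ ^ 2 * N ≤ 8 * k * σ ^ 2 * (0.7253 * (√(D + l) + 1) * √E) ^ 2 := by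
      refine le_trans ?_ hγR
      rw [sq, mul_assoc]
      gcongr
    rw [← le_div_iff₀' (by positivity)] at h1
    refine h1.trans_eq (by ring)
  have hF : 0.7253 * (√(D + l) + 1) * √E ≤ Real.log T +
      (k - 1) * Real.log (64 * (σ ^ 2 / γ ^ 2) * (Y + 2 * l) ^ 2) + 2 * l := by
    rcases le_total Y 4 with hY4 | hY4
    · exact regretFactor_le_of_le_four hk hτ hY8 hY4 hl hs hEY hD
    · exact regretFactor_le_of_four_le hk hτ hY4 hl hs hE0 hEY hD0 hD (by linarith) hE hYτ hDE'
        hND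
  have hLam : Real.log T +
      (k - 1) * Real.log (64 * (σ ^ 2 / γ ^ 2) * (Y + 2 * l) ^ 2) + 2 * l =
      Real.log T + (k - 1) * Real.log (64 * σ ^ 2 / γ ^ 2)
        + 2 * (k - 1) * Real.log (Y + 2 * l) + 2 * l := by
    rw [Real.log_mul (by positivity) (by positivity), Real.log_pow, ← mul_div_assoc]
    push_cast
    ring
  rw [hLam] at hF
  rw [div_mul_eq_mul_div, le_div_iff₀' hγ0]
  refine hγR.trans ?_
  gcongr

/-- The regret bound when the horizon is large in terms of `k`, `σ` and `γ`. -/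
theorem fairRegret_le_asymptotic (hC : C ⊆ stdSimplex ℝ (Fin k)) (hc : IsCompact C)
    (hconv : Convex ℝ C) (hσ : 1 ≤ σ) (hμ : μ ⬝ᵥ μ ≤ σ ^ 2)
    (hbest : IsBestVertex C μ vstar) (hγ : γ = vertexGap C μ vstar) (hγ0 : 0 < γ)
    (hτ : 1 ≤ Real.log T) (hστ : σ ^ 2 ≤ Real.log T)
    (hlarge : k * Real.log (1 + 96 * k ^ 2 / γ ^ 2 * Real.log T ^ 2) ≤ Real.log T)
    (hplays : IsL1OFULSequence C σ (1 / T) T p r)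
    (hnoise : ∀ t < T, noiseSum μ p r t ⬝ᵥ (designMatrix p t)⁻¹ *ᵥ noiseSum μ p r t ≤
      Real.log (designMatrix p t).det / 2 + Real.log (1 / (1 / T))) :
    fairRegret C μ p T ≤ 60 * (k / γ) * Real.log T ^ 2 := by
  have hp : ∀ t < T, p t ⬝ᵥ p t ≤ 1 := fun t ht =>
    dotProduct_self_le_one_of_mem_stdSimplex (hC (hplays t ht).1.1)
  have hT2 : (2 : ℝ) ≤ T := by
    have hT0 : (T : ℝ) ≠ 0 := by
      rintro h
      rw [h, Real.log_zero] at hτ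
      linarith
    have := Real.log_le_sub_one_of_pos (lt_of_le_of_ne (Nat.cast_nonneg T) hT0.symm)
    linarith
  have hk : (1 : ℝ) ≤ k := by exact_mod_cast one_le_of_mem_stdSimplex (hC hbest.1.1)
  obtain ⟨hN, hR⟩ := fairRegret_bounds hC hc hconv (by linarith) hμ (by positivity) hbest hγ
    hplays hnoise
  have hE := log_det_eraseVertex_le (v := vstar) hp
  have hD := log_det_le_of_norm_le_one hp
  have hDE := log_det_designMatrix_le_eraseVertex p
    (dotProduct_self_le_one_of_mem_stdSimplex (hC hbest.1.1)) T
  have hE0 := Real.log_nonneg (one_le_det_designMatrix (eraseVertex p vstar) T)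
  have hD0 := Real.log_nonneg (one_le_det_designMatrix p T)
  have hNle : (otherPlays p vstar T : ℝ) ≤ T := by exact_mod_cast otherPlays_le p vstar T
  have hN0 : (0 : ℝ) ≤ otherPlays p vstar T := Nat.cast_nonneg _
  rw [one_div_one_div] at hR
  set N : ℝ := (otherPlays p vstar T : ℝ)
  set E := Real.log (designMatrix (eraseVertex p vstar) T).det
  set D := Real.log (designMatrix p T).det
  set τ := Real.log T with hτdef
  have hkτ : 1 ≤ k * τ := by nlinarith
  have hY : k * Real.log (1 + T / k) ≤ 2 * (k * τ) := by
    linarith [mul_log_one_add_div_le (by linarith : (0 : ℝ) < k) (by linarith : (1 : ℝ) ≤ T)]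
  have hDY : D ≤ 2 * (k * τ) := hD.trans hY
  have hEY : E ≤ 2 * (k * τ) := by
    refine le_trans ?_ hY
    refine hE.trans ?_
    gcongr
  have hcoef : (√k + 1) ^ 2 / Real.log 2 ≤ 6 * k := by
    have hl := Real.log_two_gt_d9
    have h1 : √(k : ℝ) ≤ k := by rw [Real.sqrt_le_left (by linarith)]; nlinarith
    rw [div_le_iff₀ (by linarith), add_sq, Real.sq_sqrt (by linarith)]
    nlinarith
  have hwidth : (√(D + τ) + σ) ^ 2 ≤ 2 * (D + τ) + 2 * τ := by
    have h1 : √(D + τ) ^ 2 = D + τ := Real.sq_sqrt (by linarith)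
    nlinarith [sq_nonneg (√(D + τ) - σ)]
  have hγR : γ * fairRegret C μ p T ≤ 6 * k * (2 * (D + τ) + 2 * τ) * E := by
    refine hR.trans ?_
    gcongr
  have hτk : τ ≤ k * τ := le_mul_of_one_le_left (by linarith) hk
  -- The bootstrap: the crude bounds `D, E ≤ 2kτ` make `N` polylogarithmic in `T`, and then `E ≤ k
  -- log(1 + N/k)` falls below `τ` by `hlarge`. The constant is `96 = 6 · 8 · 2`.
  have hEτ : E ≤ τ := by
    have h1 : γ ^ 2 * N ≤ 96 * k ^ 3 * τ ^ 2 := by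
      calc γ ^ 2 * N = γ * (γ * N) := by ring
        _ ≤ γ * fairRegret C μ p T := by gcongr
        _ ≤ 6 * k * (2 * (D + τ) + 2 * τ) * E := hγR
        _ ≤ 6 * k * (8 * (k * τ)) * (2 * (k * τ)) := by
            have : 0 ≤ 2 * (D + τ) + 2 * τ := by linarith
            gcongr
            linarith
        _ = _ := by ring
    have h2 : N / k ≤ 96 * k ^ 2 / γ ^ 2 * τ ^ 2 := by
      rw [div_le_iff₀ (by linarith), div_mul_eq_mul_div, div_mul_eq_mul_div,
        le_div_iff₀' (by positivity)]
      refine h1.trans_eq (by ring)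
    refine hE.trans (le_trans ?_ hlarge)
    gcongr
  have hDτ : D ≤ 3 * τ := by
    have h1 : Real.log (1 + (T - N)) ≤ 2 * τ := by
      have h2 : Real.log (1 + (T - N)) ≤ Real.log ((T : ℝ) ^ 2) :=
        Real.log_le_log (by linarith) (by nlinarith)
      rwa [Real.log_pow] at h2
    linarith
  have h3 : γ * fairRegret C μ p T ≤ 60 * k * τ ^ 2 := by
    calc γ * fairRegret C μ p T ≤ 6 * k * (2 * (D + τ) + 2 * τ) * E := hγR
      _ ≤ 6 * k * (10 * τ) * τ := by
        gcongr
        linarith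
      _ = _ := by ring
  rw [← le_div_iff₀' hγ0] at h3
  exact h3.trans_eq (by ring)

theorem abs_fairRegret_le (hC : C ⊆ stdSimplex ℝ (Fin k)) (hc : IsCompact C)
    (hconv : Convex ℝ C) (hσ : 0 ≤ σ) (hμ : μ ⬝ᵥ μ ≤ σ ^ 2) (hbest : IsBestVertex C μ vstar)
    (hp : ∀ t < T, p t ∈ C) : |fairRegret C μ p T| ≤ 2 * σ * T := by
  rw [fairRegret, hbest.sSup_eq hc hconv]
  refine (Finset.abs_sum_le_sum_abs _ _).trans ?_
  have h : ∀ t ∈ Finset.range T, |μ ⬝ᵥ vstar - μ ⬝ᵥ p t| ≤ 2 * σ := by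
    intro t ht
    refine abs_le_of_sq_le_sq ?_ (by positivity)
    refine (sq_dotProduct_sub_le hμ (hC hbest.1.1) (hC (hp t (Finset.mem_range.1 ht)))).trans ?_
    nlinarith
  refine (Finset.sum_le_sum h).trans_eq ?_
  simp [mul_comm]

/-- With `x = log T` the last condition says `(1 + c x²)^k ≤ exp x`; the exponential beats
`x^(2k+1)`, whose extra factor `x` absorbs `(1 + c)^k`. -/
theorem eventually_horizon_large (k : ℕ) (σ c : ℝ) (hc : 0 ≤ c) (b : ℝ) :
    ∀ᶠ T : ℕ in Filter.atTop, 1 ≤ Real.log T ∧ σ ≤ Real.log T ∧ b ≤ Real.log T ∧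
      k * Real.log (1 + c * Real.log T ^ 2) ≤ Real.log T := by
  have hlog : Filter.Tendsto (fun T : ℕ => Real.log T) Filter.atTop Filter.atTop :=
    Real.tendsto_log_atTop.comp tendsto_natCast_atTop_atTop
  have hreal : ∀ᶠ x : ℝ in Filter.atTop, k * Real.log (1 + c * x ^ 2) ≤ x := by
    have ho : (fun x : ℝ => (x : ℝ) ^ (2 * k + 1)) =o[Filter.atTop] Real.exp :=
      Real.isLittleO_pow_exp_atTop
    filter_upwards [ho.bound one_pos, Filter.eventually_ge_atTop 1,
      Filter.eventually_ge_atTop ((1 + c) ^ k)] with x hx h1 h2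
    have hb : 1 + c * x ^ 2 ≤ (1 + c) * x ^ 2 := by nlinarith
    rw [← Real.log_pow, Real.log_le_iff_le_exp (by positivity)]
    rw [Real.norm_of_nonneg (by positivity), Real.norm_of_nonneg (Real.exp_pos x).le,
      one_mul] at hx
    calc (1 + c * x ^ 2) ^ k ≤ ((1 + c) * x ^ 2) ^ k := by gcongr
      _ = (1 + c) ^ k * x ^ (2 * k) := by rw [mul_pow, pow_mul]
      _ ≤ x * x ^ (2 * k) := by gcongr
      _ = x ^ (2 * k + 1) := by ring
      _ ≤ _ := hx
  filter_upwards [hlog.eventually_ge_atTop 1, hlog.eventually_ge_atTop σ,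
    hlog.eventually_ge_atTop b, hlog.eventually hreal] with T h1 h2 h3 h4
  exact ⟨h1, h2, h3, h4⟩

end ExplicitBound

/-! ### From sequences to random runs. -/

section Run

variable {k : ℕ} {C : Set (Fin k → ℝ)} {μ : Fin k → ℝ} {σ δ : ℝ} {T : ℕ}
  {D : Measure (Fin k → ℝ)} {Ω : Type*} {mΩ : MeasurableSpace Ω} {P : Measure Ω}
  {ℱ : Filtration ℕ mΩ} {X : ℕ → Ω → Fin k → ℝ} {a : ℕ → Ω → Fin k} {p : ℕ → Ω → Fin k → ℝ}

/-- The noise stays within the confidence radius, outside an event of probability at most `δ`. -/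
theorem IsL1OFULRun.exists_noise_controlled [IsProbabilityMeasure P]
    (h : IsL1OFULRun C σ δ T D P ℱ X a p) (hC : C ⊆ stdSimplex ℝ (Fin k))
    (hD : IsSubgaussianReward C μ (1 / 2) D) (hδ : 0 < δ) :
    ∃ S : Set Ω, MeasurableSet S ∧ P S ≤ ENNReal.ofReal δ ∧ ∀ ω ∉ S, ∀ t < T,
      noiseSum μ (fun s => p s ω) (fun s => X s ω (a s ω)) t ⬝ᵥ
        (designMatrix (fun s => p s ω) t)⁻¹ *ᵥ
          noiseSum μ (fun s => p s ω) (fun s => X s ω (a s ω)) t ≤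
      Real.log (designMatrix (fun s => p s ω) t).det / 2 + Real.log (1 / δ) := by
  -- The measurable hull of the crossing event has the same probability.
  refine ⟨toMeasurable P _, measurableSet_toMeasurable _ _,
    (measure_toMeasurable _).trans_le (h.measure_exists_mixtureValue_le hC hD hδ),
    fun ω hω t ht => ?_⟩
  refine noiseSum_quadForm_le _ _ _ hδ (not_le.1 fun hle => hω ?_)
  exact subset_toMeasurable _ _ ⟨t, ht.le, hle⟩

theorem IsL1OFULRun.measurable_fairRegret (h : IsL1OFULRun C σ δ T D P ℱ X a p) :
    Measurable fun ω => fairRegret C μ (fun t => p t ω) T := by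
  simp only [fairRegret]
  refine Finset.measurable_fun_sum _ fun t ht => measurable_const.sub ?_
  exact measurable_dotProduct measurable_const
    ((h.measurable_dist t (Finset.mem_range.1 ht)).mono (ℱ.le t) le_rfl)

end Run

theorem integral_le_of_le_off_small_set {Ω : Type*} {mΩ : MeasurableSpace Ω} {P : Measure Ω}
    [IsProbabilityMeasure P] {f : Ω → ℝ} (hf : Integrable f P) {S : Set Ω} (hS : MeasurableSet S)
    {δ M B : ℝ} (hδ : 0 ≤ δ) (hPS : P S ≤ ENNReal.ofReal δ) (hM : 0 ≤ M) (hB : 0 ≤ B)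
    (hfM : ∀ ω, f ω ≤ M) (hfB : ∀ ω ∉ S, f ω ≤ B) : ∫ ω, f ω ∂P ≤ B + δ * M := by
  have hi : Integrable (fun ω => B + S.indicator (fun _ => M) ω) P :=
    (integrable_const B).add ((integrable_const M).indicator hS)
  have h1 : ∫ ω, f ω ∂P ≤ ∫ ω, (B + S.indicator (fun _ => M) ω) ∂P := by
    refine integral_mono hf hi fun ω => ?_
    by_cases hω : ω ∈ S
    · simp only [Set.indicator_of_mem hω]
      linarith [hfM ω]
    · simpa only [Set.indicator_of_notMem hω, add_zero] using hfB ω hω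
  rw [integral_add (integrable_const B) ((integrable_const M).indicator hS),
    integral_indicator hS, setIntegral_const, integral_const] at h1
  simp only [probReal_univ, one_mul, smul_eq_mul] at h1
  refine h1.trans (add_le_add le_rfl (mul_le_mul_of_nonneg_right ?_ hM))
  exact ENNReal.toReal_le_of_le_ofReal hδ hPS

end

theorem theorem3 :
    -- the bound with probability at least `1 - δ`
    (∀ (k g : ℕ) (G : Fin g → Finset (Fin k)) (l u : Fin g → ℝ) (μ vstar : Fin k → ℝ)
      (σ γ δ : ℝ) (T : ℕ) (D : Measure (Fin k → ℝ)) (Ω : Type*) (mΩ : MeasurableSpace Ω)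
      (P : Measure Ω) (_ : IsProbabilityMeasure P) (ℱ : Filtration ℕ mΩ)
      (X : ℕ → Ω → Fin k → ℝ) (a : ℕ → Ω → Fin k) (p : ℕ → Ω → Fin k → ℝ),
      1 ≤ σ → ‖(WithLp.toLp 2 μ : EuclideanSpace ℝ (Fin k))‖ ≤ σ →
      0 < δ → δ < 1 → 1 ≤ T →
      IsBestVertex (fairPolytope G l u) μ vstar →
      γ = vertexGap (fairPolytope G l u) μ vstar → 0 < γ →
      IsSubgaussianReward (fairPolytope G l u) μ (1 / 2) D →
      IsL1OFULRun (fairPolytope G l u) σ δ T D P ℱ X a p →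
      ENNReal.ofReal (1 - δ) ≤
        P {ω | fairRegret (fairPolytope G l u) μ (fun t => p t ω) T ≤
          8 * k * σ ^ 2 / γ *
            (Real.log T + (k - 1) * Real.log (64 * σ ^ 2 / γ ^ 2)
              + 2 * (k - 1) * Real.log (k * Real.log (1 + T / k) + 2 * Real.log (1 / δ))
              + 2 * Real.log (1 / δ)) ^ 2})
    ∧
    -- the bound in expectation, for the failure probability `δ = 1 / T`
    (∃ K : ℝ, ∀ (k : ℕ) (σ γ : ℝ), 1 ≤ σ → 0 < γ → ∃ T₀ : ℕ, ∀ T ≥ T₀,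
      ∀ (g : ℕ) (G : Fin g → Finset (Fin k)) (l u : Fin g → ℝ) (μ vstar : Fin k → ℝ)
      (D : Measure (Fin k → ℝ)) (Ω : Type*) (mΩ : MeasurableSpace Ω)
      (P : Measure Ω) (_ : IsProbabilityMeasure P) (ℱ : Filtration ℕ mΩ)
      (X : ℕ → Ω → Fin k → ℝ) (a : ℕ → Ω → Fin k) (p : ℕ → Ω → Fin k → ℝ),
      ‖(WithLp.toLp 2 μ : EuclideanSpace ℝ (Fin k))‖ ≤ σ →
      IsBestVertex (fairPolytope G l u) μ vstar →
      γ = vertexGap (fairPolytope G l u) μ vstar →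
      IsSubgaussianReward (fairPolytope G l u) μ (1 / 2) D →
      IsL1OFULRun (fairPolytope G l u) σ (1 / T) T D P ℱ X a p →
      Integrable (fun ω => fairRegret (fairPolytope G l u) μ (fun t => p t ω) T) P ∧
      ∫ ω, fairRegret (fairPolytope G l u) μ (fun t => p t ω) T ∂P ≤
        K * (k / γ * (Real.log T ^ 2 + k * Real.log T + k ^ 2 * Real.log (Real.log T)))) := by
  constructor
  · intro k g G l u μ vstar σ γ δ T D Ω mΩ P hP ℱ X a p hσ hμ hδ hδ1 _ hbest hγ hγ0 hD hrun
    have hC := fairPolytope_subset_stdSimplex G l u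
    obtain ⟨S, hS, hPS, hgood⟩ := hrun.exists_noise_controlled hC hD hδ
    have h1 : ENNReal.ofReal (1 - δ) ≤ P Sᶜ := by
      rw [prob_compl_eq_one_sub hS, ENNReal.ofReal_sub _ hδ.le, ENNReal.ofReal_one]
      exact tsub_le_tsub_left hPS _
    refine h1.trans (measure_mono fun ω hω => ?_)
    exact fairRegret_le_explicit hC (isCompact_fairPolytope G l u) (convex_fairPolytope G l u) hσ
      (dotProduct_self_le_sq hμ) hδ hδ1 hbest hγ hγ0 (hrun.plays ω) (hgood ω hω)
  -- Of the constant, 60 comes from the good event. The bad event costs at most `(1/T) · 2σT = 2σ`,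
  -- which `2σγ ≤ log T` makes at most one further copy of `(k/γ) log² T`.
  · refine ⟨61, fun k σ γ hσ hγ0 => ?_⟩
    obtain ⟨T₀, hT₀⟩ := Filter.eventually_atTop.1
      (eventually_horizon_large k (σ ^ 2) (96 * k ^ 2 / γ ^ 2) (by positivity) (2 * σ * γ))
    refine ⟨T₀, ?_⟩
    intro T hT g G l u μ vstar D Ω mΩ P hP ℱ X a p hμ hbest hγ hD hrun
    obtain ⟨hτ, hστ, hγτ, hlarge⟩ := hT₀ T hT
    have hC := fairPolytope_subset_stdSimplex G l u
    have hc := isCompact_fairPolytope G l u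
    have hconv := convex_fairPolytope G l u
    have hμ' := dotProduct_self_le_sq hμ
    have hk : (1 : ℝ) ≤ k := by exact_mod_cast one_le_of_mem_stdSimplex (hC hbest.1.1)
    have hT0 : (0 : ℝ) < T := by
      refine lt_of_le_of_ne (Nat.cast_nonneg T) fun h => ?_
      rw [← h, Real.log_zero] at hτ
      linarith
    have habs : ∀ ω, |fairRegret (fairPolytope G l u) μ (fun t => p t ω) T| ≤ 2 * σ * T :=
      fun ω => abs_fairRegret_le hC hc hconv (by linarith) hμ' hbest
        fun t ht => (hrun.plays ω t ht).1.1
    have hint : Integrable (fun ω => fairRegret (fairPolytope G l u) μ (fun t => p t ω) T) P :=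
      Integrable.of_bound hrun.measurable_fairRegret.aestronglyMeasurable (2 * σ * T)
        (Filter.Eventually.of_forall habs)
    refine ⟨hint, ?_⟩
    obtain ⟨S, hS, hPS, hgood⟩ := hrun.exists_noise_controlled hC hD (by positivity)
    have h1 := integral_le_of_le_off_small_set hint hS (by positivity) hPS
      (by positivity : 0 ≤ 2 * σ * T) (by positivity : 0 ≤ 60 * (k / γ) * Real.log T ^ 2)
      (fun ω => (le_abs_self _).trans (habs ω)) fun ω hω =>
        fairRegret_le_asymptotic hC hc hconv hσ hμ' hbest hγ hγ0 hτ hστ hlarge (hrun.plays ω)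
          (hgood ω hω)
    refine h1.trans ?_
    have h2 : 1 / (T : ℝ) * (2 * σ * T) = 2 * σ := by field_simp
    have h3 : 2 * σ ≤ k / γ * Real.log T ^ 2 := by
      rw [div_mul_eq_mul_div, le_div_iff₀ hγ0]
      nlinarith
    have h4 : 0 ≤ Real.log (Real.log T) := Real.log_nonneg hτ
    have h5 : k / γ * Real.log T ^ 2 ≤ k / γ *
        (Real.log T ^ 2 + k * Real.log T + k ^ 2 * Real.log (Real.log T)) := by
      gcongr
      have : 0 ≤ k * Real.log T := by positivity
      have : 0 ≤ (k : ℝ) ^ 2 * Real.log (Real.log T) := by positivity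
      linarith
    rw [h2]
    linarith
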